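/- Let $\mathbb H=\{\lambda\in\mathbb C:\operatorname{Im}\lambda>0\}$, let $n\in\mathbb N$, and let $\mathcal D$ be the family of holomorphic maps $f:\mathbb H^n\to\mathbb H$ with $f(\lambda,\dots,\lambda)=\lambda$ for all $\lambda\in\mathbb H$, equipped with the compact-open topology and its Borel $\sigma$-algebra. The group $\mathrm{PSL}_2(\mathbb R)$ acts on $\mathbb H$ and on $\partial\mathbb H=\mathbb R\cup\{\infty\}$ by Möbius transformations, and on $\mathcal D$ by conjugation, $$(\gamma\cdot f)(z_1,\dots,z_n)=\gamma\, f(\gamma^{-1}z_1,\dots,\gamma^{-1}z_n).$$ An element of $\mathrm{PSL}_2(\mathbb R)$ is called unipotent if it fixes exactly one point of $\partial\mathbb H$. A unipotent one-parameter subgroup is a nontrivial continuous homomorphism $t\mapsto\gamma_t$ from $(\mathbb R,+)$ to $\mathrm{PSL}_2(\mathbb R)$ such that every $\gamma_t$ different from the identity is unipotent. **Theorem 5.1.** Let $f\in\mathcal D$. For each $j=1,\dots,n$ there is a real constant $\alpha_j\ge 0$ such that $\frac{\partial f}{\partial z_j}(\lambda,\dots,\lambda)=\alpha_j$ for all $\lambda\in\mathbb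 H$. Let $\{\gamma_t\}$ be any unipotent one-parameter subgroup of $\mathrm{PSL}_2(\mathbb R)$. Then there is a unique $\mathbf g\in\mathcal D$ with $\gamma_1\cdot\mathbf g=\mathbf g$ and $\frac{\partial\mathbf g}{\partial z_j}(\lambda,\dots,\lambda)=\alpha_j$ for all $\lambda\in\mathbb H$ and all $j=1,\dots,n$. For $r>0$ let $\mu_r$ be the pushforward to $\mathcal D$ of the uniform probability measure on $[-r,r]$ under the map $t\mapsto\gamma_t\cdot f$. Then $\mu_r\to\delta_{\mathbf g}$ weakly as $r\to\infty$. -/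

import Mathlib

open UpperHalfPlane MeasureTheory Filter Topology
open scoped MatrixGroups

noncomputable section

namespace DiagonalFamily

/-! ### The group `PSL(2, ℝ)` acting on the upper half-plane and on its boundary

`PSL(2, ℝ)` is the quotient of `SL(2, ℝ)` by its centre, with the quotient topology. -/

/-- `PSL(2, ℝ)` acts on `ℍ` by Moebius transformations. -/
instance : MulAction PSL(2, ℝ) ℍ :=
  MulAction.compHom ℍ (Matrix.ProjectiveSpecialLinearGroup.toPGL (n := Fin 2) (R := ℝ))

theorem mk_smul (g : SL(2, ℝ)) (z : ℍ) : (g : PSL(2, ℝ)) • z = g • z := rfl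

theorem scalar_smul_boundary (c : ℝˣ) (x : OnePoint ℝ) :
    Matrix.GeneralLinearGroup.scalar (Fin 2) c • x = x := by
  induction x with
  | infty => simp [OnePoint.smul_infty_eq_ite]
  | coe x => simp [OnePoint.smul_some_eq_ite]

/-- `PGL(2, ℝ)`, hence `PSL(2, ℝ)`, acts on the boundary `∂ℍ = ℝ ∪ {∞}` by Moebius
transformations. -/
instance : MulAction PGL(2, ℝ) (OnePoint ℝ) :=
  Matrix.ProjGenLinGroup.mulActionOfGL scalar_smul_boundary

instance : MulAction PSL(2, ℝ) (OnePoint ℝ) :=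
  MulAction.compHom (OnePoint ℝ) (Matrix.ProjectiveSpecialLinearGroup.toPGL (n := Fin 2) (R := ℝ))

theorem mk_smul_boundary (g : SL(2, ℝ)) (x : OnePoint ℝ) :
    (g : PSL(2, ℝ)) • x = (g : GL (Fin 2) ℝ) • x := rfl

instance : ContinuousSMul PSL(2, ℝ) ℍ where
  continuous_smul := by
    have hq : IsOpenQuotientMap
        (Prod.map (QuotientGroup.mk : SL(2, ℝ) → PSL(2, ℝ)) (id : ℍ → ℍ)) :=
      QuotientGroup.isOpenQuotientMap_mk.prodMap IsOpenQuotientMap.id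
    refine hq.isQuotientMap.continuous_iff.2 ?_
    exact (continuous_smul : Continuous fun p : SL(2, ℝ) × ℍ => p.1 • p.2)

/-- An element of `PSL(2, ℝ)` is unipotent (parabolic) if it fixes exactly one boundary point. -/
def IsUnipotent (γ : PSL(2, ℝ)) : Prop := ∃! x : OnePoint ℝ, γ • x = x

/-- A unipotent one-parameter subgroup: a nontrivial continuous homomorphism `t ↦ γ t` from
`(ℝ, +)` to `PSL(2, ℝ)` all of whose non-identity values are unipotent. -/
structure IsUnipotentSubgroup (γ : ℝ → PSL(2, ℝ)) : Prop where
  continuous : Continuous γ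
  map_add : ∀ s t, γ (s + t) = γ s * γ t
  nontrivial : ∃ t, γ t ≠ 1
  unipotent : ∀ t, γ t ≠ 1 → IsUnipotent (γ t)

/-! ### The family of holomorphic maps `ℍⁿ → ℍ` restricting to the identity on the diagonal -/

variable {n : ℕ}

/-- A map `ℍⁿ → ℍ` as a map `ℂⁿ → ℂ`; only the values on `ℍⁿ ⊆ ℂⁿ` are meaningful. -/
def toComplexFun (f : (Fin n → ℍ) → ℍ) (z : Fin n → ℂ) : ℂ :=
  (f fun j => ofComplex (z j) : ℍ)

/-- Holomorphy of a map `ℍⁿ → ℍ`: complex differentiability on the open set `ℍⁿ ⊆ ℂⁿ`. -/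
def IsHolomorphic (f : (Fin n → ℍ) → ℍ) : Prop :=
  DifferentiableOn ℂ (toComplexFun f) {z | ∀ j, 0 < (z j).im}

/-- The partial derivative `∂f/∂z_j` at a point `z` of `ℍⁿ`. -/
def partialDeriv (f : (Fin n → ℍ) → ℍ) (j : Fin n) (z : Fin n → ℍ) : ℂ :=
  deriv (fun w : ℂ => toComplexFun f (Function.update (fun k => (z k : ℂ)) j w)) (z j)

/-- The family `𝒟` of holomorphic maps `ℍⁿ → ℍ` with `f (λ, …, λ) = λ` for all `λ`. It carries the
compact-open topology, as a subspace of the space of continuous maps. -/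
def D (n : ℕ) : Type :=
  {f : C(Fin n → ℍ, ℍ) // IsHolomorphic f ∧ ∀ l : ℍ, f (fun _ => l) = l}

namespace D

instance : TopologicalSpace (D n) :=
  instTopologicalSpaceSubtype

instance : MeasurableSpace (D n) := borel (D n)

instance : BorelSpace (D n) := ⟨rfl⟩

instance : CoeFun (D n) fun _ => (Fin n → ℍ) → ℍ := ⟨fun f => f.1⟩

@[ext] theorem ext {f g : D n} (h : ∀ z, f z = g z) : f = g :=
  Subtype.ext (ContinuousMap.ext h)

end D

theorem isHolomorphic_conj {f : (Fin n → ℍ) → ℍ} (hf : IsHolomorphic f) (γ δ : PSL(2, ℝ)) :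
    IsHolomorphic fun z => γ • f fun j => δ • z j := by
  have key : ∀ γ : PSL(2, ℝ), ∀ w : ℂ, 0 < w.im →
      DifferentiableAt ℂ (fun w : ℂ => ((γ • ofComplex w : ℍ) : ℂ)) w := by
    intro γ w hw
    induction γ using QuotientGroup.induction_on with
    | H g =>
      have h := analyticAt_smul (g := (g : GL (Fin 2) ℝ)) (by simp) ⟨w, hw⟩
      exact h.differentiableAt
  have hopen : IsOpen {z : Fin n → ℂ | ∀ j, 0 < (z j).im} := by
    have h := isOpen_set_pi (s := fun _ : Fin n => {w : ℂ | 0 < w.im}) Set.finite_univ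
      fun _ _ => isOpen_upperHalfPlaneSet
    convert h using 1
    ext z
    simp [Set.mem_pi]
  intro z hz
  apply DifferentiableAt.differentiableWithinAt
  have h1 : DifferentiableAt ℂ (fun z : Fin n → ℂ => fun j => ((δ • ofComplex (z j) : ℍ) : ℂ)) z :=
    differentiableAt_pi.2 fun j =>
      DifferentiableAt.comp (f := fun z : Fin n → ℂ => z j) z (key δ (z j) (hz j))
        (differentiableAt_apply j z)
  have h2 : DifferentiableAt ℂ (toComplexFun f)
      (fun j => ((δ • ofComplex (z j) : ℍ) : ℂ)) :=
    hf.differentiableAt (hopen.mem_nhds fun j => (δ • ofComplex (z j) : ℍ).im_pos)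
  have h3 := h2.comp z h1
  have h4 := (key γ (toComplexFun f (fun j => ((δ • ofComplex (z j) : ℍ) : ℂ)))
    (UpperHalfPlane.im_pos _)).comp z h3
  refine h4.congr_of_eventuallyEq (Eventually.of_forall fun w => ?_)
  simp [toComplexFun, Function.comp_def]

/-- The conjugation action of `PSL(2, ℝ)` on `𝒟`:
`(γ • f) (z₁, …, zₙ) = γ (f (γ⁻¹ z₁, …, γ⁻¹ zₙ))`. -/
instance : MulAction PSL(2, ℝ) (D n) where
  smul γ f := ⟨⟨fun z => γ • f fun j => γ⁻¹ • z j,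
      (f.1.continuous.comp (by fun_prop)).const_smul γ⟩,
    isHolomorphic_conj f.2.1 γ γ⁻¹, fun l => by
      change γ • f (fun _ => γ⁻¹ • l) = l
      rw [f.2.2, smul_inv_smul]⟩
  one_smul f := D.ext fun z => by
    change (1 : PSL(2, ℝ)) • f (fun j => (1 : PSL(2, ℝ))⁻¹ • z j) = f z
    simp
  mul_smul γ δ f := D.ext fun z => by
    change (γ * δ) • f (fun j => (γ * δ)⁻¹ • z j) = γ • δ • f (fun j => δ⁻¹ • γ⁻¹ • z j)
    simp [mul_smul]

theorem D.smul_apply (γ : PSL(2, ℝ)) (f : D n) (z : Fin n → ℍ) :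
    (γ • f) z = γ • f fun j => γ⁻¹ • z j := rfl

/-- Orbit maps of continuous curves in `PSL(2, ℝ)` are continuous for the compact-open topology. -/
theorem continuous_orbit {γ : ℝ → PSL(2, ℝ)} (hγ : Continuous γ) (f : D n) :
    Continuous fun t => γ t • f := by
  have h : Continuous fun p : ℝ × (Fin n → ℍ) => γ p.1 • f fun j => (γ p.1)⁻¹ • p.2 j := by
    refine (hγ.comp continuous_fst).smul (f.1.continuous.comp (continuous_pi fun j => ?_))
    exact (hγ.comp continuous_fst).inv.smul ((continuous_apply j).comp continuous_snd)
  exact Continuous.subtype_mk (ContinuousMap.curry ⟨_, h⟩).continuous _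

/-! ### Uniform measures on intervals and their pushforwards to `𝒟` -/

/-- The uniform probability measure on `[-r, r]`, for `r > 0`. -/
def uniformMeasure (r : Set.Ioi (0 : ℝ)) : ProbabilityMeasure ℝ :=
  ⟨ProbabilityTheory.cond volume (Set.Icc (-r : ℝ) r),
    ProbabilityTheory.cond_isProbabilityMeasure_of_finite
      (by have := r.2.out; simp; linarith) (by simp)⟩

/-- The probability measure `μ_r` on `𝒟`: the pushforward of the uniform measure on `[-r, r]` under
the orbit map `t ↦ γ t • f`. -/
def orbitMeasure {γ : ℝ → PSL(2, ℝ)} (hγ : IsUnipotentSubgroup γ) (f : D n)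
    (r : Set.Ioi (0 : ℝ)) : ProbabilityMeasure (D n) :=
  (uniformMeasure r).map (continuous_orbit hγ.continuous f).measurable.aemeasurable

end DiagonalFamily

end

noncomputable section

namespace DiagonalFamily

variable {n : ℕ}

/-! ### The Schwarz–Pick inequality on polyhalfplanes -/

/-! Much more than convergence of averages holds: the orbit `γ t • f` itself converges as `|t| → ∞`,
to a limit determined by the derivatives `α` (`HasDiagDeriv.exists_tendsto`). The averages then
converge by dominated convergence. A map fixed by `γ 1` is constant along its orbit at positive
integer times, so it equals its limit; this gives uniqueness.

After conjugation, `γ t` is a translation and the orbit is `f (z - t) + t`; the limit is the linear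
map `∑ α_j z_j`. For a real vector `b`, the function `φ w = f (w + b)` is a Pick function of one
variable. The Taylor estimate on the diagonal at `iY` gives `φ (iY) = iY + ∑ α_j b_j + O(1/Y)`. By
Julia's lemma, `k w = φ w - w - ∑ α_j b_j` is again Pick, and it is `O(1/Y)` at `iY`. Hence either
`k = 0` or `-1/k` is a Pick function with positive angular derivative at `∞`. Such a function tends
to infinity along horizontal lines, so `k` tends to `0` there (`IsPick.tendsto_zero`).

This settles only points whose coordinates share one imaginary part. Schwarz–Pick makes `𝒟` a normal
family, and the identity theorem on a complex line identifies every limit point of the orbit with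
the linear map.

The same Schwarz–Pick bound controls the derivative on the diagonal: it has norm at most one and
sends `(1, …, 1)` to `1`, so its coefficients are nonnegative reals. They depend holomorphically on
the base point, hence are constant. -/

theorem sub_conj_ne_zero {z w : ℂ} (hz : 0 < z.im) (hw : 0 < w.im) :
    w - (starRingEnd ℂ) z ≠ 0 := by
  intro h
  have := congrArg Complex.im h
  simp at this
  linarith

theorem norm_sub_conj_sq (z w : ℂ) :
    ‖w - (starRingEnd ℂ) z‖ ^ 2 = ‖w - z‖ ^ 2 + 4 * (z.im * w.im) := by
  simp only [← Complex.normSq_eq_norm_sq, Complex.normSq_apply, Complex.sub_re, Complex.sub_im,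
    Complex.conj_re, Complex.conj_im]
  ring

/-- The Cayley transform from the unit disc to the upper half-plane sending `0` to `z`. -/
def cayley (z ζ : ℂ) : ℂ := (z - (starRingEnd ℂ) z * ζ) / (1 - ζ)

theorem one_sub_ne_zero {ζ : ℂ} (hζ : ‖ζ‖ < 1) : 1 - ζ ≠ 0 := by
  intro h
  have : ζ = 1 := by linear_combination -h
  simp [this] at hζ

theorem cayley_zero (z : ℂ) : cayley z 0 = z := by simp [cayley]

theorem cayley_im_pos {z ζ : ℂ} (hz : 0 < z.im) (hζ : ‖ζ‖ < 1) : 0 < (cayley z ζ).im := by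
  have h1 : (cayley z ζ).im = z.im * (1 - ‖ζ‖ ^ 2) / Complex.normSq (1 - ζ) := by
    rw [cayley, Complex.div_im, ← Complex.normSq_eq_norm_sq]
    have : Complex.normSq (1 - ζ) ≠ 0 := by simpa using one_sub_ne_zero hζ
    field_simp
    simp [Complex.normSq_apply]
    ring
  rw [h1]
  have h2 : 0 < Complex.normSq (1 - ζ) := Complex.normSq_pos.2 (one_sub_ne_zero hζ)
  have h3 : ‖ζ‖ ^ 2 < 1 := by nlinarith [norm_nonneg ζ]
  have : 0 < 1 - ‖ζ‖ ^ 2 := by linarith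
  positivity

theorem cayley_inv {z w : ℂ} (hz : 0 < z.im) (hw : 0 < w.im) :
    cayley z ((w - z) / (w - (starRingEnd ℂ) z)) = w := by
  have h1 := sub_conj_ne_zero hz hw
  have h2 := sub_conj_ne_zero hz hz
  rw [cayley]
  have h3 : 1 - (w - z) / (w - (starRingEnd ℂ) z) =
      (z - (starRingEnd ℂ) z) / (w - (starRingEnd ℂ) z) := by field_simp; ring
  rw [h3, div_eq_iff (div_ne_zero h2 h1)]
  field_simp
  ring

theorem differentiableAt_cayley {z ζ : ℂ} (hζ : ‖ζ‖ < 1) : DifferentiableAt ℂ (cayley z) ζ := by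
  unfold cayley
  exact DifferentiableAt.div (by fun_prop) (by fun_prop) (one_sub_ne_zero hζ)

/-- The product of `ι` copies of the upper half-plane, as a subset of `ℂ^ι`. -/
def polyHalfPlane (ι : Type*) : Set (ι → ℂ) := {z | ∀ j, 0 < (z j).im}

theorem isOpen_polyHalfPlane (ι : Type*) [Finite ι] : IsOpen (polyHalfPlane ι) := by
  have h := isOpen_set_pi (s := fun _ : ι => {w : ℂ | 0 < w.im}) Set.finite_univ
    fun _ _ => isOpen_upperHalfPlaneSet
  convert h using 1
  ext z
  simp [Set.mem_pi, polyHalfPlane]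

/-- The Schwarz–Pick inequality: holomorphic maps between products of half-planes do not increase
the maximum of the pseudo-hyperbolic distances. -/
theorem schwarz_pick {ι : Type*} [Fintype ι] {f : (ι → ℂ) → ℂ}
    (hf : DifferentiableOn ℂ f (polyHalfPlane ι)) (hpos : ∀ z ∈ polyHalfPlane ι, 0 < (f z).im)
    {z w : ι → ℂ} (hz : z ∈ polyHalfPlane ι) (hw : w ∈ polyHalfPlane ι) {r : ℝ} (hr : r < 1)
    (hr0 : 0 ≤ r) (h : ∀ j, ‖w j - z j‖ ≤ r * ‖w j - (starRingEnd ℂ) (z j)‖) :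
    ‖f w - f z‖ ≤ r * ‖f w - (starRingEnd ℂ) (f z)‖ := by
  set Φ : (ι → ℂ) → ι → ℂ := fun ζ j => cayley (z j) (ζ j) with hΦ
  have hball : ∀ ζ ∈ Metric.ball (0 : ι → ℂ) 1, ∀ j, ‖ζ j‖ < 1 := fun ζ hζ j =>
    (norm_le_pi_norm ζ j).trans_lt (by simpa using hζ)
  have hmaps : ∀ ζ ∈ Metric.ball (0 : ι → ℂ) 1, Φ ζ ∈ polyHalfPlane ι := fun ζ hζ j =>
    cayley_im_pos (hz j) (hball ζ hζ j)
  -- Read through Cayley transforms, `f` is a map from the unit polydisc (the sup-norm ball) to the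
  -- disc fixing the origin, so the Schwarz lemma on normed spaces applies.
  set ψ : (ι → ℂ) → ℂ := fun ζ => (f (Φ ζ) - f z) / (f (Φ ζ) - (starRingEnd ℂ) (f z)) with hψ
  have hne : ∀ ζ ∈ Metric.ball (0 : ι → ℂ) 1, f (Φ ζ) - (starRingEnd ℂ) (f z) ≠ 0 :=
    fun ζ hζ => sub_conj_ne_zero (hpos z hz) (hpos _ (hmaps ζ hζ))
  have hd : DifferentiableOn ℂ ψ (Metric.ball 0 1) := by
    have h1 : DifferentiableOn ℂ Φ (Metric.ball 0 1) := by
      intro ζ hζ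
      refine DifferentiableAt.differentiableWithinAt (differentiableAt_pi.2 fun j => ?_)
      exact DifferentiableAt.comp (f := fun ζ : ι → ℂ => ζ j) ζ
        (differentiableAt_cayley (hball ζ hζ j)) (differentiableAt_apply j ζ)
    have h2 : DifferentiableOn ℂ (fun ζ => f (Φ ζ)) (Metric.ball 0 1) := hf.comp h1 hmaps
    simp only [hψ, div_eq_mul_inv]
    exact (h2.sub_const _).mul ((h2.sub_const _).inv hne)
  have hm : Set.MapsTo ψ (Metric.ball 0 1) (Metric.closedBall 0 1) := by
    intro ζ hζ
    rw [mem_closedBall_zero_iff, hψ]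
    simp only [norm_div]
    refine div_le_one_of_le₀ ?_ (norm_nonneg _)
    refine le_of_sq_le_sq ?_ (norm_nonneg _)
    rw [norm_sub_conj_sq]
    have := mul_pos (hpos z hz) (hpos _ (hmaps ζ hζ))
    linarith
  have hΦ0 : Φ 0 = z := funext fun j => by simp [hΦ, cayley_zero]
  have hψ0 : ψ 0 = 0 := by simp [hψ, hΦ0]
  set ζ : ι → ℂ := fun j => (w j - z j) / (w j - (starRingEnd ℂ) (z j)) with hζ
  have hζr : ‖ζ‖ ≤ r := by
    refine (pi_norm_le_iff_of_nonneg hr0).2 fun j => ?_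
    rw [hζ]
    simp only [norm_div]
    exact div_le_of_le_mul₀ (norm_nonneg _) hr0 (h j)
  have hΦζ : Φ ζ = w := funext fun j => cayley_inv (hz j) (hw j)
  have := Complex.norm_le_norm_of_mapsTo_ball hd hm hψ0 (hζr.trans_lt hr)
  have h3 := this.trans hζr
  rw [hψ] at h3
  simp only [hΦζ, norm_div] at h3
  rwa [div_le_iff₀ (norm_pos_iff.2 (sub_conj_ne_zero (hpos z hz) (hpos w hw)))] at h3

/-! ### Pick functions -/

/-- A Pick function: a holomorphic map from the upper half-plane to the closed one. -/
structure IsPick (p : ℂ → ℂ) : Prop where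
  differentiableOn : DifferentiableOn ℂ p {z | 0 < z.im}
  im_nonneg : ∀ z, 0 < z.im → 0 ≤ (p z).im

/-- The two-point Schwarz–Pick inequality, also for real-valued constants. -/
theorem IsPick.norm_sub_sq_le {p : ℂ → ℂ} (hp : IsPick p) {z w : ℂ} (hz : 0 < z.im)
    (hw : 0 < w.im) :
    ‖p w - p z‖ ^ 2 * (z.im * w.im) ≤ ‖w - z‖ ^ 2 * ((p z).im * (p w).im) := by
  -- Adding `ε * I` pushes the values into the open half-plane, where Schwarz–Pick applies; then `ε
  -- → 0`. The product form survives when `(p z).im = 0`.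
  have key : ∀ ε : ℝ, 0 < ε →
      ‖p w - p z‖ ^ 2 * (z.im * w.im) ≤ ‖w - z‖ ^ 2 * (((p z).im + ε) * ((p w).im + ε)) := by
    intro ε hε
    set f : (Unit → ℂ) → ℂ := fun z => p (z ()) + ε * Complex.I with hf
    have hd : DifferentiableOn ℂ f (polyHalfPlane Unit) := by
      have h : DifferentiableOn ℂ (fun z : Unit → ℂ => z ()) (polyHalfPlane Unit) := fun z _ =>
        (differentiableAt_apply () z).differentiableWithinAt
      exact (hp.differentiableOn.comp h fun z hz => hz ()).add_const _
    have hpos : ∀ z ∈ polyHalfPlane Unit, 0 < (f z).im := fun z hz => by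
      have := hp.im_nonneg _ (hz ())
      simp [hf]; linarith
    have hne := norm_pos_iff.2 (sub_conj_ne_zero hz hw)
    set r := ‖w - z‖ / ‖w - (starRingEnd ℂ) z‖ with hr
    have hr2 : r ^ 2 * (‖w - z‖ ^ 2 + 4 * (z.im * w.im)) = ‖w - z‖ ^ 2 := by
      rw [← norm_sub_conj_sq, hr]; field_simp
    have hr1 : r < 1 := by
      rw [hr, div_lt_one hne]
      refine lt_of_pow_lt_pow_left₀ 2 (norm_nonneg _) ?_
      rw [norm_sub_conj_sq]
      have := mul_pos hz hw
      linarith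
    have h := schwarz_pick hd hpos (z := fun _ => z) (w := fun _ => w) (fun _ => hz) (fun _ => hw)
      hr1 (by positivity) (fun _ => by rw [hr]; field_simp; rfl)
    have h2 := pow_le_pow_left₀ (norm_nonneg _) h 2
    rw [mul_pow, norm_sub_conj_sq] at h2
    simp only [hf, add_sub_add_right_eq_sub, Complex.add_im, Complex.mul_im, Complex.ofReal_re,
      Complex.I_im, mul_one, Complex.ofReal_im, Complex.I_re, mul_zero, add_zero] at h2
    have hD : 0 < ‖w - z‖ ^ 2 + 4 * (z.im * w.im) := by have := mul_pos hz hw; positivity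
    have h3 := mul_le_mul_of_nonneg_right h2 hD.le
    have h4 : r ^ 2 * (‖p w - p z‖ ^ 2 + 4 * (((p z).im + ε) * ((p w).im + ε))) *
        (‖w - z‖ ^ 2 + 4 * (z.im * w.im)) =
        ‖w - z‖ ^ 2 * (‖p w - p z‖ ^ 2 + 4 * (((p z).im + ε) * ((p w).im + ε))) := by
      rw [mul_right_comm, hr2]
    rw [h4] at h3
    linarith
  have hlim : Tendsto (fun ε : ℝ => ‖w - z‖ ^ 2 * (((p z).im + ε) * ((p w).im + ε))) (𝓝[>] 0)
      (𝓝 (‖w - z‖ ^ 2 * (((p z).im + 0) * ((p w).im + 0)))) := by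
    refine Tendsto.mono_left (Continuous.tendsto (by fun_prop) 0) nhdsWithin_le_nhds
  have := ge_of_tendsto hlim (eventually_nhdsWithin_of_forall key)
  simpa using this

theorem tendsto_const_div_atTop (c : ℝ) : Tendsto (fun Y : ℝ => c / Y) atTop (𝓝 0) :=
  tendsto_const_nhds.div_atTop tendsto_id

/-- Julia's lemma at the boundary point `∞`. -/
theorem IsPick.mul_im_le {p : ℂ → ℂ} (hp : IsPick p) {a c : ℝ} (ha : 0 < a)
    (h : ∀ᶠ Y : ℝ in atTop, a * Y - c ≤ ‖p (Y * Complex.I)‖) {z : ℂ} (hz : 0 < z.im) :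
    a * z.im ≤ (p z).im := by
  have hl : Tendsto (fun Y : ℝ => (a - (c + 2 * ‖p z‖) / Y) * z.im) atTop
      (𝓝 ((a - 0) * z.im)) :=
    (tendsto_const_nhds.sub (tendsto_const_div_atTop _)).mul_const _
  have hr : Tendsto (fun Y : ℝ => (1 + ‖z‖ / Y) ^ 2 * (p z).im) atTop
      (𝓝 ((1 + 0) ^ 2 * (p z).im)) :=
    ((tendsto_const_nhds.add (tendsto_const_div_atTop _)).pow 2).mul_const _
  have hlin : Tendsto (fun Y : ℝ => a * Y - c) atTop atTop :=
    tendsto_atTop_add_const_right _ _ (tendsto_id.const_mul_atTop ha)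
  -- Both sides are the two-point inequality between `z` and `iY`, divided by `Y ^ 2`.
  have key := le_of_tendsto_of_tendsto hl hr <| by
    filter_upwards [h, eventually_gt_atTop 0, hlin.eventually_gt_atTop 0] with Y hY hY0 hpos
    set w : ℂ := Y * Complex.I with hw
    have hwim : w.im = Y := by simp [hw]
    have hwn : ‖w‖ = Y := by simp [hw, abs_of_pos hY0]
    have h1 := hp.norm_sub_sq_le hz (w := w) (by rw [hwim]; exact hY0)
    rw [hwim] at h1
    have hq : 0 < ‖p w‖ := hpos.trans_le hY
    have h2 : ‖w - z‖ ≤ Y + ‖z‖ := (norm_sub_le _ _).trans (by rw [hwn])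
    have h3 : (p w).im ≤ ‖p w‖ := Complex.im_le_norm _
    have h4 : ‖p w‖ - ‖p z‖ ≤ ‖p w - p z‖ := norm_sub_norm_le _ _
    have h5 : -(‖p w‖ - ‖p z‖) ≤ ‖p w - p z‖ := by
      rw [neg_sub]; exact norm_sub_rev (p w) (p z) ▸ norm_sub_norm_le _ _
    have h6 : (‖p w‖ - ‖p z‖) ^ 2 ≤ ‖p w - p z‖ ^ 2 := sq_le_sq' (by linarith) h4
    have hpz := hp.im_nonneg z hz
    have hpw := hp.im_nonneg w (by rw [hwim]; exact hY0)
    have h7 : ‖w - z‖ ^ 2 * ((p z).im * (p w).im) ≤ (Y + ‖z‖) ^ 2 * ((p z).im * ‖p w‖) := by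
      gcongr
    -- Dropping the square of `‖p z‖` leaves a factor `‖p w‖` on both sides, to be cancelled.
    have h8 : (‖p w‖ - 2 * ‖p z‖) * (z.im * Y) * ‖p w‖ ≤ (Y + ‖z‖) ^ 2 * (p z).im * ‖p w‖ := by
      have : (‖p w‖ - ‖p z‖) ^ 2 * (z.im * Y) ≤ ‖p w - p z‖ ^ 2 * (z.im * Y) := by gcongr
      nlinarith [mul_nonneg (sq_nonneg ‖p z‖) (mul_pos hz hY0).le]
    have h9 := le_of_mul_le_mul_right h8 hq
    have h10 : (a * Y - c - 2 * ‖p z‖) * (z.im * Y) ≤ (Y + ‖z‖) ^ 2 * (p z).im := by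
      refine le_trans ?_ h9
      gcongr
    have e1 : (a - (c + 2 * ‖p z‖) / Y) * z.im =
        (a * Y - c - 2 * ‖p z‖) * (z.im * Y) / Y ^ 2 := by field_simp; ring
    have e2 : (1 + ‖z‖ / Y) ^ 2 * (p z).im = (Y + ‖z‖) ^ 2 * (p z).im / Y ^ 2 := by
      field_simp
    rw [e1, e2]
    gcongr
  simpa using key

/-- A Pick function with vanishing angular derivative at `∞` grows sublinearly along the imaginary
axis. -/
theorem IsPick.tendsto_norm_div {p : ℂ → ℂ} (hp : IsPick p)
    (h : ∀ ε : ℝ, 0 < ε → ∃ z : ℂ, 0 < z.im ∧ (p z).im ≤ ε * z.im) :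
    Tendsto (fun Y : ℝ => ‖p (Y * Complex.I)‖ / Y) atTop (𝓝 0) := by
  refine Metric.tendsto_nhds.2 fun δ hδ => ?_
  -- The factor `(2 * Y) ^ 2` below turns `δ / 16` into `δ / 4`; solving the quadratic inequality
  -- for `X` costs another factor of two.
  obtain ⟨z, hz, hpz⟩ := h (δ / 16) (by positivity)
  have hsmall := (tendsto_const_div_atTop (2 * ‖p z‖)).eventually_lt_const
    (show (0 : ℝ) < δ / 2 by positivity)
  filter_upwards [hsmall, eventually_gt_atTop 0, eventually_ge_atTop ‖z‖] with Y hY hY0 hYz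
  set w : ℂ := Y * Complex.I with hw
  have hwim : w.im = Y := by simp [hw]
  have hwn : ‖w‖ = Y := by simp [hw, abs_of_pos hY0]
  have h1 := hp.norm_sub_sq_le hz (w := w) (by rw [hwim]; exact hY0)
  rw [hwim] at h1
  set X := ‖p w - p z‖ with hX
  have h2 : ‖w - z‖ ≤ 2 * Y := (norm_sub_le _ _).trans (by rw [hwn]; linarith)
  have hpz0 := hp.im_nonneg z hz
  have hpw0 := hp.im_nonneg w (by rw [hwim]; exact hY0)
  have h3 : ‖p w‖ ≤ X + ‖p z‖ := by
    calc ‖p w‖ = ‖(p w - p z) + p z‖ := by rw [sub_add_cancel]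
      _ ≤ _ := norm_add_le _ _
  have h4 : (p w).im ≤ X + ‖p z‖ := (Complex.im_le_norm _).trans h3
  have h5 : X ^ 2 * (z.im * Y) ≤ (2 * Y) ^ 2 * (δ / 16 * z.im * (X + ‖p z‖)) := by
    refine h1.trans ?_
    gcongr
  have h6 : X ^ 2 ≤ δ / 4 * Y * (X + ‖p z‖) := by
    refine le_of_mul_le_mul_right ?_ (mul_pos hz hY0)
    linarith
  have hX0 : 0 ≤ X := norm_nonneg _
  have h7 : X ≤ δ / 2 * Y + ‖p z‖ := by
    by_contra! hc
    have hδY : 0 < δ * Y := by positivity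
    nlinarith [norm_nonneg (p z)]
  rw [Real.dist_eq, sub_zero, abs_of_nonneg (by positivity), div_lt_iff₀ hY0]
  rw [div_lt_iff₀ hY0] at hY
  linarith

/-- The right side of the two-point inequality vanishes: a Pick function touching the real line is
constant. -/
theorem IsPick.eq_of_im_eq_zero {p : ℂ → ℂ} (hp : IsPick p) {z w : ℂ} (hz : 0 < z.im)
    (hw : 0 < w.im) (h : (p z).im = 0) : p w = p z := by
  have h1 := hp.norm_sub_sq_le hz hw
  rw [h, zero_mul, mul_zero] at h1
  have h2 : ‖p w - p z‖ ^ 2 ≤ 0 := by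
    by_contra! hc
    have := mul_pos hc (mul_pos hz hw)
    linarith
  have h3 : ‖p w - p z‖ = 0 := by simpa using le_antisymm h2 (sq_nonneg _)
  exact sub_eq_zero.1 (norm_eq_zero.1 h3)

/-- A Pick function with positive linear growth along the imaginary axis tends to infinity along
every horocycle at `∞`. -/
theorem IsPick.tendsto_norm_atTop {p : ℂ → ℂ} (hp : IsPick p) {a : ℝ} (ha : 0 < a)
    (h : ∀ᶠ Y : ℝ in atTop, a * Y ≤ ‖p (Y * Complex.I)‖) {z : ℂ} (hz : 0 < z.im) :
    Tendsto (fun t : ℝ => ‖p (z + t)‖) (cocompact ℝ) atTop := by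
  set S : Set ℝ := (fun w : ℂ => (p w).im / w.im) '' {w | 0 < w.im} with hS
  have hlow : ∀ x ∈ S, a ≤ x := by
    rintro _ ⟨w, hw, rfl⟩
    rw [le_div_iff₀ hw]
    exact hp.mul_im_le (c := 0) ha (by simpa using h) hw
  have hne : S.Nonempty := ⟨_, z, hz, rfl⟩
  -- `A` is the angular derivative of `p` at `∞`. Subtracting `A * w` leaves a Pick function `N`
  -- with angular derivative zero, so `N (iY) = o(Y)`.
  set A := sInf S with hA
  have hA0 : 0 < A := ha.trans_le (le_csInf hne hlow)
  have hAle : ∀ w : ℂ, 0 < w.im → A * w.im ≤ (p w).im := fun w hw => by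
    rw [← le_div_iff₀ hw]
    exact csInf_le ⟨a, hlow⟩ ⟨w, hw, rfl⟩
  set N : ℂ → ℂ := fun w => p w - A * w with hN
  have hNP : IsPick N := by
    refine ⟨hp.differentiableOn.sub (by fun_prop), fun w hw => ?_⟩
    have := hAle w hw
    simp [hN]; linarith
  have hNlim := hNP.tendsto_norm_div fun ε hε => by
    obtain ⟨_, ⟨w, hw, rfl⟩, hlt⟩ := exists_lt_of_csInf_lt hne (show sInf S < A + ε by linarith)
    refine ⟨w, hw, ?_⟩
    have hlt' : (p w).im / w.im < A + ε := hlt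
    rw [div_lt_iff₀ hw] at hlt'
    simp [hN]; linarith
  refine tendsto_atTop.2 fun M' => ?_
  obtain ⟨M, hM, hM0⟩ : ∃ M, M' ≤ M ∧ 0 ≤ M := ⟨max M' 0, le_max_left _ _, le_max_right _ _⟩
  have hL : Tendsto (fun Y : ℝ => A * (1 - ‖z‖ / Y) - M / Y - ‖N (Y * Complex.I)‖ / Y) atTop
      (𝓝 (A * (1 - 0) - 0 - 0)) :=
    (((tendsto_const_nhds.sub (tendsto_const_div_atTop _)).const_mul A).sub
      (tendsto_const_div_atTop _)).sub hNlim
  have hG : Tendsto (fun Y : ℝ =>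
      (A * (1 - ‖z‖ / Y) - M / Y - ‖N (Y * Complex.I)‖ / Y) ^ 2 * z.im -
        (‖z‖ / Y + 2) ^ 2 * (M * (‖N (Y * Complex.I)‖ / Y))) atTop
      (𝓝 ((A * (1 - 0) - 0 - 0) ^ 2 * z.im - (0 + 2) ^ 2 * (M * 0))) :=
    ((hL.pow 2).mul_const _).sub
      ((((tendsto_const_div_atTop _).add_const 2).pow 2).mul (hNlim.const_mul M))
  have hev := (hL.eventually_const_lt (show (0 : ℝ) < _ by simpa using hA0)).and
    ((hG.eventually_const_lt (show (0 : ℝ) < _ by simp; positivity)).and (eventually_gt_atTop 0))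
  filter_upwards [(tendsto_norm_cocompact_atTop (E := ℝ)).eventually hev] with t ht
  obtain ⟨hLt, hGt, hY0⟩ := ht
  set Y : ℝ := ‖t‖ with hY
  -- If `p (z + t)` stayed bounded by `M`, then `N (z + t)` would have size about `A * Y` but
  -- imaginary part at most `M`. Comparing `z + t` with `iY` for `N` puts order `Y ^ 3` below `o(Y ^
  -- 3)`.
  by_contra! hc
  have hpM : ‖p (z + t)‖ ≤ M := hc.le.trans hM
  set w : ℂ := Y * Complex.I with hw
  have hwim : w.im = Y := by simp [hw]
  have hwn : ‖w‖ = Y := by simp [hw, abs_of_pos hY0]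
  have hztim : (z + t).im = z.im := by simp
  have h1 := hNP.norm_sub_sq_le (z := w) (w := z + t) (by rw [hwim]; exact hY0)
    (by rw [hztim]; exact hz)
  rw [hwim, hztim] at h1
  have htn : ‖(t : ℂ)‖ = Y := by simp [hY]
  have h2 : ‖z + t - w‖ ≤ ‖z‖ + 2 * Y := by
    calc ‖z + t - w‖ ≤ ‖z + t‖ + ‖w‖ := norm_sub_le _ _
      _ ≤ ‖z‖ + ‖(t : ℂ)‖ + ‖w‖ := by gcongr; exact norm_add_le _ _
      _ = _ := by rw [htn, hwn]; ring
  have h3 : (N (z + t)).im ≤ M := by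
    have h31 : (N (z + t)).im = (p (z + t)).im - A * z.im := by simp [hN]
    have := (Complex.im_le_norm (p (z + t))).trans hpM
    have := mul_pos hA0 hz
    linarith
  have h4 : (N w).im ≤ ‖N w‖ := Complex.im_le_norm _
  have h5 : A * (Y - ‖z‖) - M - ‖N w‖ ≤ ‖N (z + t) - N w‖ := by
    have e : (A : ℂ) * (z + t) = p (z + t) - (N (z + t) - N w) - N w := by simp only [hN]; ring
    have h51 : A * (Y - ‖z‖) ≤ ‖(A : ℂ) * (z + t)‖ := by
      rw [norm_mul, Complex.norm_real, Real.norm_of_nonneg hA0.le]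
      gcongr
      have := norm_sub_le (z + t) z
      rw [add_sub_cancel_left, htn] at this
      linarith
    have h52 : ‖(A : ℂ) * (z + t)‖ ≤ ‖p (z + t)‖ + ‖N (z + t) - N w‖ + ‖N w‖ := by
      rw [e]
      exact (norm_sub_le _ _).trans (by gcongr; exact norm_sub_le _ _)
    linarith
  have hNw0 := hNP.im_nonneg w (by rw [hwim]; exact hY0)
  have hNz0 := hNP.im_nonneg (z + t) (by rw [hztim]; exact hz)
  have e1 : A * (Y - ‖z‖) - M - ‖N w‖ = (A * (1 - ‖z‖ / Y) - M / Y - ‖N w‖ / Y) * Y := by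
    field_simp
  have h6 : ((A * (1 - ‖z‖ / Y) - M / Y - ‖N w‖ / Y) * Y) ^ 2 ≤ ‖N (z + t) - N w‖ ^ 2 := by
    rw [← e1]
    refine pow_le_pow_left₀ ?_ h5 2
    rw [e1]
    positivity
  have h7 : ((A * (1 - ‖z‖ / Y) - M / Y - ‖N w‖ / Y) * Y) ^ 2 * (Y * z.im) ≤
      (‖z‖ + 2 * Y) ^ 2 * (‖N w‖ * M) := by
    calc _ ≤ ‖N (z + t) - N w‖ ^ 2 * (Y * z.im) := by gcongr
      _ ≤ _ := h1
      _ ≤ _ := by gcongr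
  have e2 : (‖z‖ + 2 * Y) ^ 2 * (‖N w‖ * M) =
      ((‖z‖ / Y + 2) ^ 2 * (M * (‖N w‖ / Y))) * Y ^ 3 := by field_simp
  have h8 : 0 < Y ^ 3 := by positivity
  nlinarith [mul_pos hGt h8]

/-- A Pick function that is `O(1 / Y)` at `iY` tends to zero along every horocycle at `∞`. -/
theorem IsPick.tendsto_zero {k : ℂ → ℂ} (hk : IsPick k) {C : ℝ}
    (h : ∀ᶠ Y : ℝ in atTop, ‖k (Y * Complex.I)‖ ≤ C / Y) {z : ℂ} (hz : 0 < z.im) :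
    Tendsto (fun t : ℝ => k (z + t)) (cocompact ℝ) (𝓝 0) := by
  have hzt : ∀ t : ℝ, 0 < (z + t).im := fun t => by simpa using hz
  by_cases hex : ∃ w : ℂ, 0 < w.im ∧ (k w).im = 0
  · obtain ⟨w, hw, hw0⟩ := hex
    have h0 : k w = 0 := by
      refine norm_le_zero_iff.1 (ge_of_tendsto (tendsto_const_div_atTop C) ?_)
      filter_upwards [h, eventually_gt_atTop 0] with Y hY hY0
      rwa [hk.eq_of_im_eq_zero hw (by simpa using hY0) hw0] at hY
    have : (fun t : ℝ => k (z + t)) = fun _ => 0 := funext fun t => by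
      rw [hk.eq_of_im_eq_zero hw (hzt t) hw0, h0]
    rw [this]
    exact tendsto_const_nhds
  · push Not at hex
    have hne : ∀ w : ℂ, 0 < w.im → k w ≠ 0 := fun w hw hw0 => hex w hw (by simp [hw0])
    set p : ℂ → ℂ := fun w => -(k w)⁻¹ with hp
    have hpP : IsPick p := by
      refine ⟨(hk.differentiableOn.inv hne).neg, fun w hw => ?_⟩
      simp only [hp, Complex.neg_im, Complex.inv_im, neg_div, neg_neg]
      exact div_nonneg (hk.im_nonneg w hw) (Complex.normSq_nonneg _)
    have hp' : Tendsto (fun t : ℝ => ‖p (z + t)‖) (cocompact ℝ) atTop := by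
      -- `max C 1` only serves to make the slope positive.
      refine hpP.tendsto_norm_atTop (a := (max C 1)⁻¹) (by positivity) ?_ hz
      filter_upwards [h, eventually_gt_atTop 0] with Y hY hY0
      have hkpos := norm_pos_iff.2 (hne (Y * Complex.I) (by simpa using hY0))
      have hC : ‖k (Y * Complex.I)‖ ≤ max C 1 / Y := hY.trans (by gcongr; exact le_max_left _ _)
      simp only [hp, norm_neg, norm_inv]
      rw [inv_mul_eq_div, ← inv_div]
      exact inv_anti₀ hkpos hC
    rw [tendsto_zero_iff_norm_tendsto_zero]
    refine (tendsto_inv_atTop_zero.comp hp').congr fun t => ?_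
    simp [hp]

/-! ### The Schwarz–Pick lemma for elements of `𝒟` and pointwise convergence -/

theorem toComplexFun_coe (f : (Fin n → ℍ) → ℍ) (z : Fin n → ℍ) :
    toComplexFun f (fun j => (z j : ℂ)) = f z := by
  simp [toComplexFun]

theorem toComplexFun_im_pos (f : (Fin n → ℍ) → ℍ) (z : Fin n → ℂ) :
    0 < (toComplexFun f z).im := UpperHalfPlane.im_pos _

theorem tanh_le_tanh_iff {x y : ℝ} : Real.tanh x ≤ Real.tanh y ↔ x ≤ y := by
  rw [← Real.artanh_le_artanh_iff ⟨Real.neg_one_lt_tanh x, Real.tanh_lt_one x⟩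
    ⟨Real.neg_one_lt_tanh y, Real.tanh_lt_one y⟩, Real.artanh_tanh, Real.artanh_tanh]

namespace D

theorem differentiableOn (f : D n) : DifferentiableOn ℂ (toComplexFun f) (polyHalfPlane (Fin n)) :=
  f.2.1

theorem differentiableAt (f : D n) {z : Fin n → ℂ} (hz : z ∈ polyHalfPlane (Fin n)) :
    DifferentiableAt ℂ (toComplexFun f) z :=
  f.differentiableOn.differentiableAt ((isOpen_polyHalfPlane _).mem_nhds hz)

theorem toComplexFun_diag (f : D n) {l : ℂ} (hl : 0 < l.im) :
    toComplexFun f (fun _ => l) = l := by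
  have h := toComplexFun_coe f fun _ => (⟨l, hl⟩ : ℍ)
  rw [f.2.2] at h
  exact h

theorem schwarz_pick (f : D n) {z w : Fin n → ℂ} (hz : z ∈ polyHalfPlane (Fin n))
    (hw : w ∈ polyHalfPlane (Fin n)) {r : ℝ} (hr : r < 1) (hr0 : 0 ≤ r)
    (h : ∀ j, ‖w j - z j‖ ≤ r * ‖w j - (starRingEnd ℂ) (z j)‖) :
    ‖toComplexFun f w - toComplexFun f z‖ ≤
      r * ‖toComplexFun f w - (starRingEnd ℂ) (toComplexFun f z)‖ :=
  DiagonalFamily.schwarz_pick f.differentiableOn (fun z _ => toComplexFun_im_pos f z) hz hw hr hr0 h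

/-- `tanh (dist / 2)` is the pseudo-hyperbolic distance, so Schwarz–Pick is a Lipschitz bound with
constant one, uniform over `𝒟`. It supplies the equicontinuity behind normality. -/
theorem dist_le (f : D n) (z w : Fin n → ℍ) : dist (f z) (f w) ≤ dist z w := by
  have key : ∀ a b : ℍ, Real.tanh (dist b a / 2) * ‖(b : ℂ) - (starRingEnd ℂ) (a : ℂ)‖ =
      ‖(b : ℂ) - a‖ := fun a b => by
    rw [tanh_half_dist, dist_eq_norm, dist_eq_norm,
      div_mul_cancel₀ _ (norm_pos_iff.2 (sub_conj_ne_zero a.im_pos b.im_pos)).ne']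
  have h := f.schwarz_pick (z := fun j => (z j : ℂ)) (w := fun j => (w j : ℂ))
    (fun j => (z j).im_pos) (fun j => (w j).im_pos) (Real.tanh_lt_one (dist w z / 2))
    (by
      have := tanh_le_tanh_iff.2 (show 0 ≤ dist w z / 2 by positivity)
      simpa using this) fun j => by
      rw [← key]
      gcongr
      exact tanh_le_tanh_iff.2 (by have := dist_le_pi_dist w z j; linarith)
  rw [toComplexFun_coe, toComplexFun_coe, ← key] at h
  have h1 := le_of_mul_le_mul_right h
    (norm_pos_iff.2 (sub_conj_ne_zero (f z).im_pos (f w).im_pos))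
  rw [tanh_le_tanh_iff] at h1
  rw [dist_comm, dist_comm z]
  linarith

/-- Pointwise convergence of elements of `𝒟` to a continuous map is locally uniform. -/
theorem tendsto_continuousMap {ι : Type*} {l : Filter ι} {F : ι → D n} {g : C(Fin n → ℍ, ℍ)}
    (h : ∀ z, Tendsto (fun i => F i z) l (𝓝 (g z))) : Tendsto (fun i => (F i).1) l (𝓝 g) := by
  refine ContinuousMap.tendsto_iff_tendstoLocallyUniformly.2 ?_
  refine Metric.tendstoLocallyUniformly_iff.2 fun ε hε x => ?_
  refine ⟨Metric.ball x (ε / 3) ∩ {y | dist (g y) (g x) < ε / 3},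
    inter_mem (Metric.ball_mem_nhds _ (by positivity))
      (Metric.tendsto_nhds.1 (g.continuous.tendsto x) _ (by positivity)), ?_⟩
  filter_upwards [Metric.tendsto_nhds.1 (h x) (ε / 3) (by positivity)] with i hi y ⟨hy, h1⟩
  have h2 := (F i).dist_le x y
  have hy' : dist y x < ε / 3 := hy
  have h1' : dist (g y) (g x) < ε / 3 := h1
  have h3 := dist_triangle4 (g y) (g x) (F i x) (F i y)
  rw [dist_comm] at hi
  rw [dist_comm x y] at h2
  exact h3.trans_lt (by linarith)

/-- In `𝒟`, pointwise convergence implies convergence in the compact-open topology. -/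
theorem tendsto_of_forall_tendsto {ι : Type*} {l : Filter ι} {F : ι → D n} {g : D n}
    (h : ∀ z, Tendsto (fun i => F i z) l (𝓝 (g z))) : Tendsto F l (𝓝 g) :=
  tendsto_subtype_rng.2 (tendsto_continuousMap h)

theorem continuous_apply (z : Fin n → ℍ) : Continuous fun f : D n => f z :=
  (continuous_eval_const z).comp continuous_subtype_val

instance : T2Space (D n) := inferInstanceAs (T2Space (Subtype _))

/-! ### The derivative along the diagonal -/

/-- Euclidean form of Schwarz–Pick. The ball of radius `ε * l.im` lies in the pseudo-hyperbolic ball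
of radius `r = ε / (2 - ε)`, which lies in the Euclidean ball of radius `2r / (1 - r) = ε / (1 - ε)`
times `l.im`. -/
theorem norm_toComplexFun_sub_le (f : D n) {l : ℂ} (hl : 0 < l.im) {ε : ℝ} (hε : 0 < ε) (hε1 : ε < 1)
    {z : Fin n → ℂ} (hz : ‖z - fun _ => l‖ ≤ ε * l.im) :
    z ∈ polyHalfPlane (Fin n) ∧ ‖toComplexFun f z - l‖ ≤ ε / (1 - ε) * l.im := by
  have hzj : ∀ j, ‖z j - l‖ ≤ ε * l.im := fun j => (norm_le_pi_norm (z - fun _ => l) j).trans hz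
  have hzP : z ∈ polyHalfPlane (Fin n) := fun j => by
    have h1 := (Complex.abs_im_le_norm (z j - l)).trans (hzj j)
    rw [Complex.sub_im, abs_le] at h1
    nlinarith
  refine ⟨hzP, ?_⟩
  have hε2 : 0 < 1 - ε := by linarith
  have hε3 : 0 < 2 - ε := by linarith
  have hconj : ‖l - (starRingEnd ℂ) l‖ = 2 * l.im := by
    rw [Complex.sub_conj]
    simp [abs_of_pos hl]
  have h := f.schwarz_pick (z := fun _ => l) (fun _ => hl) hzP (r := ε / (2 - ε))
    (by rw [div_lt_one hε3]; linarith) (by positivity) fun j => by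
      have h1 : 2 * l.im - ‖z j - l‖ ≤ ‖z j - (starRingEnd ℂ) l‖ := by
        rw [← hconj, ← norm_neg (z j - l)]
        refine (norm_sub_norm_le _ _).trans_eq ?_
        congr 1
        ring
      rw [div_mul_eq_mul_div, le_div_iff₀ hε3]
      have h2 := hzj j
      have h3 : ε * ((2 - ε) * l.im) ≤ ε * ‖z j - (starRingEnd ℂ) l‖ := by
        gcongr
        linarith
      nlinarith
  rw [f.toComplexFun_diag hl] at h
  have h4 : ‖toComplexFun f z - (starRingEnd ℂ) l‖ ≤ ‖toComplexFun f z - l‖ + 2 * l.im := by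
    rw [← hconj]
    refine le_of_eq_of_le ?_ (norm_add_le _ _)
    congr 1
    ring
  rw [div_mul_eq_mul_div, le_div_iff₀ hε3] at h
  rw [div_mul_eq_mul_div, le_div_iff₀ hε2]
  nlinarith

/-- The derivative at the diagonal point `(l, …, l)`. -/
def diagDeriv (f : D n) (l : ℂ) : (Fin n → ℂ) →L[ℂ] ℂ := fderiv ℂ (toComplexFun f) fun _ => l

theorem hasFDerivAt_diagDeriv (f : D n) {l : ℂ} (hl : 0 < l.im) :
    HasFDerivAt (toComplexFun f) (f.diagDeriv l) (fun _ => l) :=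
  (f.differentiableAt (fun _ => hl)).hasFDerivAt

theorem norm_diagDeriv_le_div (f : D n) {l : ℂ} (hl : 0 < l.im) {ε : ℝ} (hε : 0 < ε)
    (hε1 : ε < 1) : ‖f.diagDeriv l‖ ≤ 1 / (1 - ε) := by
  have hε2 : 0 < 1 - ε := by linarith
  have h := Complex.norm_fderiv_le_div_of_mapsTo_ball (f := toComplexFun f) (c := fun _ => l)
    (R₁ := ε * l.im) (R₂ := ε / (1 - ε) * l.im) ?_ ?_ (by positivity)
  · refine h.trans_eq ?_
    field_simp
  · refine f.differentiableOn.mono fun z hz => ?_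
    rw [mem_ball_iff_norm] at hz
    exact (f.norm_toComplexFun_sub_le hl hε hε1 hz.le).1
  · intro z hz
    rw [mem_ball_iff_norm] at hz
    rw [mem_closedBall_iff_norm, f.toComplexFun_diag hl]
    exact (f.norm_toComplexFun_sub_le hl hε hε1 hz.le).2

/-- Letting `ε → 0` gives the sharp constant one, which is what forces nonnegative coefficients. -/
theorem norm_diagDeriv_le (f : D n) {l : ℂ} (hl : 0 < l.im) : ‖f.diagDeriv l‖ ≤ 1 := by
  have hlim : Tendsto (fun ε : ℝ => 1 / (1 - ε)) (𝓝[>] 0) (𝓝 (1 / (1 - 0))) := by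
    refine Tendsto.mono_left (ContinuousAt.tendsto ?_) nhdsWithin_le_nhds
    exact continuousAt_const.div (by fun_prop) (by norm_num)
  have := ge_of_tendsto hlim (by
    filter_upwards [self_mem_nhdsWithin, nhdsWithin_le_nhds (gt_mem_nhds one_pos)] with ε h1 h2
    exact f.norm_diagDeriv_le_div hl h1 h2)
  simpa using this

theorem diagDeriv_one (f : D n) {l : ℂ} (hl : 0 < l.im) : f.diagDeriv l (fun _ => 1) = 1 := by
  have h1 : HasDerivAt (fun w : ℂ => fun _ : Fin n => w) (fun _ => 1) l :=
    hasDerivAt_pi.2 fun _ => hasDerivAt_id l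
  have h2 := (f.hasFDerivAt_diagDeriv hl).comp_hasDerivAt l h1
  have h3 : (toComplexFun f ∘ fun w : ℂ => fun _ : Fin n => w) =ᶠ[𝓝 l] id := by
    filter_upwards [isOpen_upperHalfPlaneSet.mem_nhds hl] with w hw
    exact f.toComplexFun_diag hw
  exact (h2.congr_of_eventuallyEq h3.symm).unique (hasDerivAt_id l)

/-- Second order Taylor estimate at the diagonal. -/
theorem norm_sub_sub_diagDeriv_le (f : D n) {l : ℂ} (hl : 0 < l.im) {b : Fin n → ℂ}
    (hb : 2 * ‖b‖ < l.im) :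
    ‖toComplexFun f (fun j => l + b j) - l - f.diagDeriv l b‖ ≤ 8 * ‖b‖ ^ 2 / l.im := by
  set c : Fin n → ℂ := fun _ => l with hc
  set L := f.diagDeriv l with hL
  set H : (Fin n → ℂ) → ℂ := fun z => toComplexFun f z - L (z - c) with hH
  have hHc : H c = l := by simp [hH, hc, f.toComplexFun_diag hl]
  have hLn : ‖L‖ ≤ 1 := f.norm_diagDeriv_le hl
  have hball : ∀ z ∈ Metric.ball c (l.im / 2), ‖z - c‖ ≤ 1 / 2 * l.im := fun z hz => by
    rw [mem_ball_iff_norm] at hz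
    linarith
  -- Schwarz lemma for a map vanishing to second order: `R₂ * (‖b‖ / R₁) ^ 2` equals `8 * ‖b‖ ^ 2 /
  -- l.im`. On the ball, `f` moves at most `l.im` from `l` and `L` contributes at most `l.im / 2`,
  -- so `R₂ = 2 * l.im` suffices.
  have h := Complex.dist_le_mul_div_pow_of_mapsTo_ball_of_isLittleO (f := H) (c := c)
    (z := fun j => l + b j) (R₁ := l.im / 2) (R₂ := 2 * l.im) (n := 1) ?_ ?_ ?_ ?_
  · have hcb : (fun j => l + b j) - c = b := by ext j; simp [hc]
    rw [dist_eq_norm, dist_eq_norm, hHc, hcb] at h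
    simp only [hH, hcb] at h
    convert h using 1
    · congr 1; ring
    · rw [one_add_one_eq_two]
      field_simp
      ring
  · refine DifferentiableOn.sub ?_ (by fun_prop)
    exact f.differentiableOn.mono fun z hz =>
      (f.norm_toComplexFun_sub_le hl (by norm_num) (by norm_num) (hball z hz)).1
  · intro z hz
    have h1 := (f.norm_toComplexFun_sub_le hl (by norm_num) (by norm_num) (hball z hz)).2
    rw [mem_closedBall_iff_norm, hHc]
    have h2 : ‖L (z - c)‖ ≤ 1 * (1 / 2 * l.im) :=
      (L.le_opNorm _).trans (by gcongr; exact hball z hz)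
    have h3 : H z - l = (toComplexFun f z - l) - L (z - c) := by simp only [hH]; ring
    rw [h3]
    refine (norm_sub_le _ _).trans ?_
    norm_num at h1 h2 ⊢
    linarith
  · have h1 := (f.hasFDerivAt_diagDeriv hl).isLittleO
    rw [f.toComplexFun_diag hl] at h1
    have h2 : (fun z => H z - H c) = fun z => toComplexFun f z - l - L (z - c) := by
      ext z; rw [hHc]; simp only [hH]; ring
    rw [h2]
    simpa using h1.norm_right
  · rw [mem_ball_iff_norm]
    have hcb : (fun j => l + b j) - c = b := by ext j; simp [hc]
    rw [hcb]
    linarith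

theorem hasDerivAt_update_diag (f : D n) (j : Fin n) {l : ℂ} (hl : 0 < l.im) :
    HasDerivAt (fun w : ℂ => toComplexFun f (Function.update (fun _ => l) j w))
      (f.diagDeriv l (Pi.single j 1)) l := by
  have h0 : Function.update (fun _ : Fin n => l) j l = fun _ => l := Function.update_eq_self j _
  exact (h0.symm ▸ f.hasFDerivAt_diagDeriv hl).comp_hasDerivAt l
    (hasDerivAt_update (𝕜 := ℂ) (fun _ : Fin n => l) j l)

theorem partialDeriv_diag (f : D n) (j : Fin n) (l : ℍ) :
    partialDeriv f j (fun _ => l) = f.diagDeriv l (Pi.single j 1) :=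
  (f.hasDerivAt_update_diag j l.im_pos).deriv

end D

theorem apply_eq_sum_single (L : (Fin n → ℂ) →L[ℂ] ℂ) (b : Fin n → ℂ) :
    L b = ∑ j, b j * L (Pi.single j 1) := by
  have h := LinearMap.pi_apply_eq_sum_univ (L : (Fin n → ℂ) →ₗ[ℂ] ℂ) b
  simp only [ContinuousLinearMap.coe_coe, smul_eq_mul] at h
  rw [h]
  refine Finset.sum_congr rfl fun j _ => ?_
  congr 2
  ext i
  simp [Pi.single_apply, eq_comm]

/-- A linear functional of sup-norm at most one which maps `(1, …, 1)` to `1` has nonnegative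
coefficients. -/
theorem apply_single_eq_ofReal_re {L : (Fin n → ℂ) →L[ℂ] ℂ} (hL : ‖L‖ ≤ 1)
    (h1 : L (fun _ => 1) = 1) (j : Fin n) :
    0 ≤ (L (Pi.single j 1)).re ∧ L (Pi.single j 1) = ((L (Pi.single j 1)).re : ℂ) := by
  set d : Fin n → ℂ := fun j => L (Pi.single j 1) with hd
  have hsum : ∀ b : Fin n → ℂ, L b = ∑ j, b j * d j := apply_eq_sum_single L
  have hle : ∑ j, ‖d j‖ ≤ 1 := by
    -- Testing on conjugate phases bounds the `ℓ¹` norm of the coefficients by one. Since their real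
    -- parts sum to one, each coefficient equals its modulus. Zero coefficients get phase `0 / 0 =
    -- 0`.
    set b : Fin n → ℂ := fun j => (starRingEnd ℂ) (d j) / ‖d j‖ with hb
    have hbn : ‖b‖ ≤ 1 := (pi_norm_le_iff_of_nonneg zero_le_one).2 fun j => by
      simp only [hb, norm_div, RCLike.norm_conj, Complex.norm_real, norm_norm]
      exact div_self_le_one _
    have hLb : L b = ((∑ j, ‖d j‖ : ℝ) : ℂ) := by
      rw [hsum, Complex.ofReal_sum]
      refine Finset.sum_congr rfl fun j _ => ?_
      by_cases h0 : d j = 0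
      · simp [h0]
      · have : (‖d j‖ : ℂ) ≠ 0 := by simpa using h0
        simp only [hb]
        rw [div_mul_eq_mul_div, mul_comm, Complex.mul_conj, Complex.normSq_eq_norm_sq]
        field_simp
        push_cast
        ring
    have h2 := (L.le_opNorm b).trans (mul_le_one₀ hL (norm_nonneg _) hbn)
    rw [hLb, Complex.norm_real, Real.norm_of_nonneg (by positivity)] at h2
    exact h2
  have hre : ∑ j, (d j).re = 1 := by
    have := congrArg Complex.re ((hsum fun _ => 1).symm.trans h1)
    simpa using this
  have hz : ∀ j ∈ Finset.univ, (d j).re = ‖d j‖ := by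
    refine (Finset.sum_eq_sum_iff_of_le fun j _ => Complex.re_le_norm _).1 (le_antisymm ?_ ?_)
    · exact Finset.sum_le_sum fun j _ => Complex.re_le_norm _
    · rw [hre]; exact hle
  have hj := hz j (Finset.mem_univ j)
  refine ⟨?_, ?_⟩
  · change 0 ≤ (d j).re
    rw [hj]; exact norm_nonneg _
  · exact (Complex.re_eq_norm.1 hj).2 |> fun h => Complex.ext (by simp) (by simpa using h.symm)

namespace D

/-- Difference quotients with real step are holomorphic in `l` on the whole half-plane, and the
Taylor estimate makes them converge locally uniformly. -/
theorem differentiableOn_diagDeriv (f : D n) (j : Fin n) :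
    DifferentiableOn ℂ (fun l => f.diagDeriv l (Pi.single j 1)) {l | 0 < l.im} := by
  set e : Fin n → ℂ := Pi.single j 1 with he
  have hen : ‖e‖ = 1 := by rw [he, Pi.norm_single, norm_one]
  set Q : ℝ → ℂ → ℂ := fun s l => (toComplexFun f (fun i => l + s * e i) - l) / s with hQ
  have hlim : TendstoLocallyUniformlyOn Q (fun l => f.diagDeriv l e) (𝓝[≠] 0) {l | 0 < l.im} := by
    refine Metric.tendstoLocallyUniformlyOn_iff.2 fun ε hε l hl => ?_
    have hl0 : 0 < l.im := hl
    refine ⟨{w | l.im / 2 < w.im}, mem_nhdsWithin_of_mem_nhds <|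
      (isOpen_lt continuous_const Complex.continuous_im).mem_nhds (by simpa using hl0), ?_⟩
    have hs1 : ∀ᶠ s : ℝ in 𝓝[≠] 0, |s| < l.im / 4 :=
      nhdsWithin_le_nhds
        ((continuous_abs.tendsto' 0 0 abs_zero).eventually_lt_const (by positivity))
    have hs2 : ∀ᶠ s : ℝ in 𝓝[≠] 0, |s| < ε * (l.im / 2) / 8 :=
      nhdsWithin_le_nhds
        ((continuous_abs.tendsto' 0 0 abs_zero).eventually_lt_const (by positivity))
    filter_upwards [hs1, hs2, self_mem_nhdsWithin] with s h1 h2 hs w hw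
    have hs0 : s ≠ 0 := hs
    have hw' : l.im / 2 < w.im := hw
    have hwpos : 0 < w.im := by linarith
    have hbn : ‖(s : ℂ) • e‖ = |s| := by rw [norm_smul, hen]; simp
    have h3 := f.norm_sub_sub_diagDeriv_le hwpos (b := (s : ℂ) • e) (by rw [hbn]; linarith)
    rw [hbn, map_smul] at h3
    simp only [Pi.smul_apply, smul_eq_mul] at h3
    have hsC : (s : ℂ) ≠ 0 := by exact_mod_cast hs0
    have h4 : f.diagDeriv w e - Q s w = -((toComplexFun f (fun i => w + s * e i) - w -
        s * f.diagDeriv w e) / s) := by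
      simp only [hQ]; field_simp; ring
    rw [dist_eq_norm, h4, norm_neg, norm_div, Complex.norm_real, Real.norm_eq_abs,
      div_lt_iff₀ (abs_pos.2 hs0)]
    refine h3.trans_lt ?_
    rw [div_lt_iff₀ hwpos]
    have h5 : 0 < |s| := abs_pos.2 hs0
    have h6 : 8 * |s| < ε * w.im := by nlinarith
    nlinarith
  refine hlim.differentiableOn (Eventually.of_forall fun s => ?_) isOpen_upperHalfPlaneSet
  refine DifferentiableOn.div_const (DifferentiableOn.sub ?_ differentiableOn_id) _
  refine DifferentiableOn.comp (f := fun l (i : Fin n) => l + s * e i) f.differentiableOn ?_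
    fun l hl i => ?_
  · exact (differentiable_pi.2 fun i => by fun_prop).differentiableOn
  · have hei : ((s : ℂ) * e i).im = 0 := by
      simp only [he, Pi.single_apply]; split_ifs <;> simp
    have hl' : 0 < l.im := hl
    simpa [hei] using hl'

/-- A real-valued holomorphic function on a connected open set is constant. -/
theorem exists_diagDeriv_eq (f : D n) :
    ∃ α : Fin n → ℝ, (∀ j, 0 ≤ α j) ∧
      ∀ l : ℂ, 0 < l.im → ∀ j, f.diagDeriv l (Pi.single j 1) = α j := by
  have h := fun (l : ℂ) (hl : 0 < l.im) =>
    apply_single_eq_ofReal_re (f.norm_diagDeriv_le hl) (f.diagDeriv_one hl)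
  have hI : 0 < Complex.I.im := by simp
  refine ⟨fun j => (f.diagDeriv Complex.I (Pi.single j 1)).re, fun j => (h _ hI j).1,
    fun l hl j => ?_⟩
  rw [← (h _ hI j).2]
  have hconn : IsConnected {l : ℂ | 0 < l.im} :=
    (convex_halfSpace_im_gt 0).isConnected ⟨_, hI⟩
  obtain ⟨w, hw⟩ := AnalyticOnNhd.eq_const_of_im_eq_const
    ((f.differentiableOn_diagDeriv j).analyticOnNhd isOpen_upperHalfPlaneSet) (c₀ := 0)
    (fun l hl => by rw [(h l hl j).2]; simp) isOpen_upperHalfPlaneSet hconn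
  exact (hw l hl).trans (hw _ hI).symm

end D

/-! ### Translations -/

/-- The matrix of the translation `z ↦ z + t`. -/
def translationMatrix (t : ℝ) : SL(2, ℝ) := ⟨!![1, t; 0, 1], by simp⟩

/-- The translation `z ↦ z + t` as an element of `PSL(2, ℝ)`. -/
def translation (t : ℝ) : PSL(2, ℝ) := (translationMatrix t : PSL(2, ℝ))

theorem translation_smul (t : ℝ) (z : ℍ) : translation t • z = t +ᵥ z := by
  rw [translation, mk_smul, UpperHalfPlane.ext_iff, coe_specialLinearGroup_apply, coe_vadd]
  simp [translationMatrix, add_comm]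

theorem coe_translationMatrix (t : ℝ) :
    (translationMatrix t : Matrix (Fin 2) (Fin 2) ℝ) = !![1, t; 0, 1] := rfl

theorem translationMatrix_mul (s t : ℝ) :
    translationMatrix s * translationMatrix t = translationMatrix (s + t) := by
  apply Subtype.ext
  rw [Matrix.SpecialLinearGroup.coe_mul]
  simp only [coe_translationMatrix]
  simp [add_comm]

theorem translationMatrix_zero : translationMatrix 0 = 1 := by
  ext i j
  fin_cases i <;> fin_cases j <;> simp [translationMatrix]

theorem translation_mul (s t : ℝ) : translation s * translation t = translation (s + t) := by
  rw [translation, translation, translation, ← QuotientGroup.mk_mul, translationMatrix_mul]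

theorem translation_zero : translation 0 = 1 := by
  rw [translation, translationMatrix_zero, QuotientGroup.mk_one]

theorem translation_inv (t : ℝ) : (translation t)⁻¹ = translation (-t) := by
  rw [inv_eq_iff_mul_eq_one, translation_mul, add_neg_cancel, translation_zero]

namespace D

theorem coe_translation_smul (f : D n) (t : ℝ) (z : Fin n → ℍ) :
    ((translation t • f) z : ℂ) = toComplexFun f (fun j => z j - t) + t := by
  rw [D.smul_apply, translation_smul, translation_inv, coe_vadd, ← toComplexFun_coe, add_comm]
  congr 3
  ext j
  rw [translation_smul, coe_vadd]
  push_cast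
  ring

/-- `∂f/∂z_j = α_j` along the diagonal, for all `j`. -/
def HasDiagDeriv (f : D n) (α : Fin n → ℝ) : Prop :=
  ∀ l : ℂ, 0 < l.im → ∀ j, f.diagDeriv l (Pi.single j 1) = α j

theorem hasDiagDeriv_iff {f : D n} {α : Fin n → ℝ} :
    f.HasDiagDeriv α ↔ ∀ (j : Fin n) (l : ℍ), partialDeriv f j (fun _ => l) = (α j : ℂ) := by
  refine ⟨fun h j l => by rw [partialDeriv_diag, h _ l.im_pos], fun h l hl j => ?_⟩
  have := h j ⟨l, hl⟩
  rwa [partialDeriv_diag] at this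

theorem HasDiagDeriv.diagDeriv_apply {f : D n} {α : Fin n → ℝ} (h : f.HasDiagDeriv α) {l : ℂ}
    (hl : 0 < l.im) (b : Fin n → ℂ) : f.diagDeriv l b = ∑ j, b j * α j := by
  rw [apply_eq_sum_single]
  exact Finset.sum_congr rfl fun j _ => by rw [h l hl]

theorem HasDiagDeriv.sum_eq_one {f : D n} {α : Fin n → ℝ} (h : f.HasDiagDeriv α) :
    ∑ j, α j = 1 := by
  have hI : 0 < Complex.I.im := by simp
  have h1 := f.diagDeriv_one hI
  rw [h.diagDeriv_apply hI] at h1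
  have h2 : ((∑ j, α j : ℝ) : ℂ) = 1 := by push_cast; simpa using h1
  exact_mod_cast h2

/-- Convergence along horocycles at `∞` for points differing from the diagonal by a real vector. -/
theorem HasDiagDeriv.tendsto_horocycle {f : D n} {α : Fin n → ℝ} (h : f.HasDiagDeriv α)
    (b : Fin n → ℝ) {l : ℂ} (hl : 0 < l.im) :
    Tendsto (fun t : ℝ => toComplexFun f (fun j => l + t + b j) - (l + t)) (cocompact ℝ)
      (𝓝 (∑ j, (b j : ℂ) * α j)) := by
  set β : Fin n → ℂ := fun j => b j with hβ
  set s : ℂ := ∑ j, (b j : ℂ) * α j with hs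
  have hsim : s.im = 0 := by simp [hs]
  set φ : ℂ → ℂ := fun w => toComplexFun f (fun j => w + β j) with hφ
  have hφP : IsPick φ := by
    refine ⟨DifferentiableOn.comp (f := fun w (i : Fin n) => w + β i) f.differentiableOn ?_
      fun w hw i => ?_, fun w _ => (toComplexFun_im_pos _ _).le⟩
    · exact (differentiable_pi.2 fun i => by fun_prop).differentiableOn
    · have hw' : 0 < w.im := hw
      simpa [hβ] using hw'
  have hest : ∀ᶠ Y : ℝ in atTop,
      ‖φ (Y * Complex.I) - Y * Complex.I - s‖ ≤ 8 * ‖β‖ ^ 2 / Y := by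
    filter_upwards [eventually_gt_atTop (2 * ‖β‖)] with Y hY
    have hY0 : 0 < Y := by linarith [norm_nonneg β]
    have him : ((Y : ℂ) * Complex.I).im = Y := by simp
    have h1 := f.norm_sub_sub_diagDeriv_le (l := Y * Complex.I) (b := β) (by rwa [him])
      (by rwa [him])
    rwa [h.diagDeriv_apply (by rwa [him]), him] at h1
  set k : ℂ → ℂ := fun w => φ w - w - s with hk
  have hkP : IsPick k := by
    refine ⟨(hφP.differentiableOn.sub differentiableOn_id).sub_const _, fun w hw => ?_⟩
    -- Julia's lemma with slope one, read off from `φ (iY) = iY + s + O(1/Y)`.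
    have h1 : 1 * w.im ≤ (φ w).im := by
      refine hφP.mul_im_le (c := 1 + ‖s‖) one_pos ?_ hw
      filter_upwards [hest, (tendsto_const_div_atTop (8 * ‖β‖ ^ 2)).eventually_lt_const one_pos,
        eventually_gt_atTop 0] with Y h1 h2 h3
      have h4 : ‖(Y : ℂ) * Complex.I‖ = Y := by simp [abs_of_pos h3]
      have h5 : (Y : ℂ) * Complex.I =
          φ (Y * Complex.I) - (φ (Y * Complex.I) - Y * Complex.I - s) - s := by ring
      have h6 := (congrArg norm h5).le.trans ((norm_sub_le _ _).trans
        (add_le_add_left (norm_sub_le _ _) _))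
      rw [h4] at h6
      linarith
    simp only [hk, Complex.sub_im, hsim]
    linarith
  have hlim := hkP.tendsto_zero hest hl
  have := hlim.add_const s
  rw [zero_add] at this
  refine this.congr fun t => ?_
  simp only [hk, hφ, hβ]
  ring

/-- The linear element `z ↦ ∑ α_j z_j` of `𝒟`. -/
def linear (α : Fin n → ℝ) (h0 : ∀ j, 0 ≤ α j) (h1 : ∑ j, α j = 1) : D n :=
  ⟨⟨fun z => ⟨∑ j, (z j : ℂ) * α j, by
      rw [Complex.im_sum]
      obtain ⟨i, -, hi⟩ : ∃ i ∈ Finset.univ, α i ≠ 0 :=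
        Finset.exists_ne_zero_of_sum_ne_zero (by rw [h1]; exact one_ne_zero)
      refine Finset.sum_pos' (fun j _ => ?_) ⟨i, Finset.mem_univ i, ?_⟩
      · simpa using mul_nonneg (z j).im_pos.le (h0 j)
      · simpa using mul_pos (z i).im_pos ((h0 i).lt_of_ne' hi)⟩, by
      refine isOpenEmbedding_coe.continuous_iff.2 ?_
      change Continuous fun z : Fin n → ℍ => ∑ j, (z j : ℂ) * (α j : ℂ)
      exact continuous_finsetSum _ fun j _ =>
        (continuous_coe.comp (_root_.continuous_apply j)).mul continuous_const⟩, by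
    have h : DifferentiableOn ℂ (fun z : Fin n → ℂ => ∑ j, z j * (α j : ℂ))
        {z | ∀ j, 0 < (z j).im} := by fun_prop
    refine h.congr fun z hz => ?_
    change ∑ j, ((ofComplex (z j) : ℍ) : ℂ) * (α j : ℂ) = ∑ j, z j * (α j : ℂ)
    refine Finset.sum_congr rfl fun j _ => ?_
    rw [ofComplex_apply_of_im_pos (hz j)], fun l => by
    ext
    change ∑ j, (l : ℂ) * (α j : ℂ) = l
    rw [← Finset.mul_sum, ← Complex.ofReal_sum, h1, Complex.ofReal_one, mul_one]⟩

theorem coe_linear_apply (α : Fin n → ℝ) (h0 : ∀ j, 0 ≤ α j) (h1 : ∑ j, α j = 1)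
    (z : Fin n → ℍ) : (linear α h0 h1 z : ℂ) = ∑ j, (z j : ℂ) * α j := rfl

theorem hasDiagDeriv_linear (α : Fin n → ℝ) (h0 : ∀ j, 0 ≤ α j) (h1 : ∑ j, α j = 1) :
    (linear α h0 h1).HasDiagDeriv α := by
  intro l hl j
  have hd : HasFDerivAt (fun z : Fin n → ℂ => ∑ j, z j * (α j : ℂ))
      (∑ j, (α j : ℂ) • ContinuousLinearMap.proj (R := ℂ) (φ := fun _ : Fin n => ℂ) j)
      (fun _ => l) :=
    HasFDerivAt.fun_sum (u := Finset.univ) fun j _ => (hasFDerivAt_apply j _).mul_const (α j : ℂ)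
  have he : toComplexFun (linear α h0 h1) =ᶠ[𝓝 fun _ => l]
      fun z : Fin n → ℂ => ∑ j, z j * (α j : ℂ) := by
    filter_upwards [(isOpen_polyHalfPlane (Fin n)).mem_nhds fun _ => hl] with z hz
    change ∑ j, ((ofComplex (z j) : ℍ) : ℂ) * (α j : ℂ) = ∑ j, z j * (α j : ℂ)
    refine Finset.sum_congr rfl fun j _ => ?_
    rw [ofComplex_apply_of_im_pos (hz j)]
  rw [((linear α h0 h1).hasFDerivAt_diagDeriv hl).unique (hd.congr_of_eventuallyEq he)]
  simp [Pi.single_apply]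

/-- `𝒟` is a normal family. -/
theorem exists_tendsto_ultrafilter {ι : Type*} (F : ι → D n) (U : Ultrafilter ι) :
    ∃ G : C(Fin n → ℍ, ℍ), Tendsto (fun i => (F i).1) U (𝓝 G) := by
  have h : ∀ z, ∃ w : ℍ, Tendsto (fun i => F i z) U (𝓝 w) := fun z => by
    -- Every element of `𝒟` sends `(I, …, I)` to `I`, so the values at `z` stay in one compact ball.
    have hK := isCompact_closedBall I (dist z fun _ => I)
    obtain ⟨w, -, hw⟩ := hK.ultrafilter_le_nhds (U.map fun i => F i z) <| by
      rw [le_principal_iff, Ultrafilter.mem_coe, Ultrafilter.mem_map]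
      refine univ_mem' fun i => ?_
      have := (F i).dist_le z fun _ => I
      rwa [(F i).2.2] at this
    exact ⟨w, hw⟩
  choose G hG using h
  have hGl : LipschitzWith 1 G := LipschitzWith.of_dist_le_mul fun z w => by
    rw [NNReal.coe_one, one_mul]
    exact le_of_tendsto ((hG z).dist (hG w)) (Eventually.of_forall fun i => (F i).dist_le z w)
  exact ⟨⟨G, hGl.continuous⟩, tendsto_continuousMap hG⟩

/-- Horocycle limits cover only points with equal imaginary parts. Any ultrafilter limit `G` is
holomorphic along a complex line that joins such points to `z`, and the identity theorem does the
rest. -/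
theorem HasDiagDeriv.tendsto_translation_apply {f : D n} {α : Fin n → ℝ} (h : f.HasDiagDeriv α)
    (h0 : ∀ j, 0 ≤ α j) (z : Fin n → ℍ) :
    Tendsto (fun t => (translation t • f) z) (cocompact ℝ) (𝓝 (linear α h0 h.sum_eq_one z)) := by
  refine (tendsto_iff_ultrafilter _ _ _).2 fun U hU => ?_
  obtain ⟨G, hG⟩ := exists_tendsto_ultrafilter (fun t => translation t • f) U
  have hGz : ∀ w, Tendsto (fun t => (translation t • f) w) U (𝓝 (G w)) := fun w =>
    ((continuous_eval_const w).tendsto G).comp hG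
  suffices hs : G z = linear α h0 h.sum_eq_one z from hs ▸ hGz z
  set c : Fin n → ℝ := fun j => (z j).re with hc
  set b : Fin n → ℝ := fun j => (z j).im - 1 with hb
  -- For real `s` this is a real translate of `(I, …, I)`; at `s = I` it is `z`. The convex set `V`
  -- contains both.
  set γ : ℂ → Fin n → ℂ := fun s j => Complex.I + c j + b j * s with hγ
  have hγim : ∀ s j, (γ s j).im = 1 + b j * s.im := fun s j => by simp [hγ]
  set V : Set ℂ := {s | ∀ j, 0 < 1 + b j * s.im} with hV
  have hVo : IsOpen V := by
    simp only [hV, Set.ofPred_forall]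
    exact isOpen_iInter_of_finite fun j => isOpen_lt continuous_const (by fun_prop)
  have hVc : Convex ℝ V := by
    intro x hx y hy p q hp hq hpq j
    have h1 := hx j
    have h2 := hy j
    have h3 : (p • x + q • y).im = p * x.im + q * y.im := by simp
    rw [h3]
    have h4 : 1 + b j * (p * x.im + q * y.im) = p * (1 + b j * x.im) + q * (1 + b j * y.im) := by
      linear_combination (-1 : ℝ) * hpq
    rw [h4]
    rcases hp.eq_or_lt with rfl | hp
    · rw [zero_add] at hpq
      simpa [hpq] using h2
    · exact add_pos_of_pos_of_nonneg (mul_pos hp h1) (mul_nonneg hq h2.le)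
  have hγV : ∀ s ∈ V, ∀ j, 0 < (γ s j).im := fun s hs j => by rw [hγim]; exact hs j
  have hVr : ∀ s : ℝ, (s : ℂ) ∈ V := fun s j => by simp
  have hVI : Complex.I ∈ V := fun j => by simpa [hb] using (z j).im_pos
  have hγd : Differentiable ℂ γ := differentiable_pi.2 fun j => by simp only [hγ]; fun_prop
  set ψ : ℂ → ℂ := fun s => (G fun j => ofComplex (γ s j) : ℍ) with hψ
  have hloc : TendstoLocallyUniformlyOn
      (fun t s => toComplexFun (translation t • f) (γ s)) ψ U V := by
    have h1 := ((ContinuousMap.continuous_postcomp (X := Fin n → ℍ)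
      ⟨((↑) : ℍ → ℂ), continuous_coe⟩).tendsto G).comp hG
    have h2 := (ContinuousMap.tendsto_iff_tendstoLocallyUniformly.1 h1).tendstoLocallyUniformlyOn
      (s := Set.univ)
    refine h2.comp (t := V) (fun s j => ofComplex (γ s j)) (Set.mapsTo_univ _ _) ?_
    refine continuousOn_pi.2 fun j s hs => ?_
    have h3 : ContinuousAt ofComplex (γ s j) :=
      (contMDiffAt_ofComplex (n := 0) (hγV s hs j)).continuousAt
    exact (ContinuousAt.comp (f := fun s => γ s j) h3
      ((continuous_pi_iff.1 hγd.continuous j).continuousAt)).continuousWithinAt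
  have hψd : DifferentiableOn ℂ ψ V := by
    refine hloc.differentiableOn (Eventually.of_forall fun t => ?_) hVo
    exact (translation t • f).differentiableOn.comp hγd.differentiableOn hγV
  set Λ : ℂ → ℂ := fun s => Complex.I + ∑ j, ((c j : ℂ) + b j * s) * α j with hΛ
  have hreal : ∀ s : ℝ, ψ s = Λ s := fun s => by
    have h1 : Tendsto (fun t => toComplexFun (translation t • f) (γ s)) U (𝓝 (ψ s)) :=
      hloc.tendsto_at (hVr s)
    have hneg : Tendsto (fun t : ℝ => -t) U (cocompact ℝ) :=
      (Homeomorph.neg ℝ).isClosedEmbedding.tendsto_cocompact.mono_left hU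
    have h2 : Tendsto (fun t : ℝ => toComplexFun f (fun j =>
        Complex.I + ((-t : ℝ) : ℂ) + ((c j + b j * s : ℝ) : ℂ)) - (Complex.I + ((-t : ℝ) : ℂ))) U
        (𝓝 (∑ j, ((c j + b j * s : ℝ) : ℂ) * α j)) :=
      (h.tendsto_horocycle (fun j => c j + b j * s) (l := Complex.I) (by simp)).comp hneg
    have h3 := h2.const_add Complex.I
    refine tendsto_nhds_unique h1 (Tendsto.congr (fun t => ?_) (by simpa [hΛ] using h3))
    have h4 := coe_translation_smul f t fun j => ⟨γ s j, hγV s (hVr s) j⟩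
    rw [← toComplexFun_coe] at h4
    have h5 : toComplexFun (translation t • f) (γ s) =
        toComplexFun f (fun j => γ s j - t) + t := h4
    rw [h5]
    have h6 : (fun j => γ s j - t) =
        fun j => Complex.I + ((-t : ℝ) : ℂ) + ((c j + b j * s : ℝ) : ℂ) := by
      ext j
      simp only [hγ]
      push_cast
      ring
    rw [h6]
    push_cast
    ring
  have hfreq : ∃ᶠ s in 𝓝[≠] (0 : ℂ), ψ s = Λ s := by
    have h1 : Tendsto (fun s : ℝ => (s : ℂ)) (𝓝[≠] 0) (𝓝[≠] 0) := by
      refine tendsto_nhdsWithin_of_tendsto_nhds_of_eventually_within _ ?_ ?_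
      · exact (Complex.continuous_ofReal.tendsto' 0 0 Complex.ofReal_zero).mono_left
          nhdsWithin_le_nhds
      · filter_upwards [self_mem_nhdsWithin] with s hs
        simpa using hs
    exact h1.frequently (Eventually.of_forall hreal).frequently
  have heq := AnalyticOnNhd.eqOn_of_preconnected_of_frequently_eq (hψd.analyticOnNhd hVo)
    ((show Differentiable ℂ Λ by simp only [hΛ]; fun_prop).differentiableOn.analyticOnNhd hVo)
    hVc.isPreconnected (by simpa using hVr 0) hfreq hVI
  have hγI : ∀ j, γ Complex.I j = z j := fun j => by
    apply Complex.ext <;> simp [hγ, hc, hb]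
  have hψI : ψ Complex.I = G z := by simp only [hψ, hγI, ofComplex_apply]
  ext
  rw [← hψI, heq, coe_linear_apply]
  have h7 : ∀ j, (c j : ℂ) + b j * Complex.I = z j - Complex.I := fun j => by
    rw [← hγI j]; simp only [hγ]; ring
  have h8 : ∑ j, (α j : ℂ) = 1 := by exact_mod_cast h.sum_eq_one
  simp only [hΛ, h7, sub_mul, Finset.sum_sub_distrib, ← Finset.mul_sum, h8]
  ring

/-- Under the translations `t ↦ z + t`, the orbit of `f` converges to a linear element as
`|t| → ∞`. -/
theorem HasDiagDeriv.tendsto_translation_smul {f : D n} {α : Fin n → ℝ} (h : f.HasDiagDeriv α)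
    (h0 : ∀ j, 0 ≤ α j) :
    Tendsto (fun t => translation t • f) (cocompact ℝ) (𝓝 (linear α h0 h.sum_eq_one)) :=
  tendsto_of_forall_tendsto (h.tendsto_translation_apply h0)

end D

/-! ### Unipotent one-parameter subgroups -/

theorem translation_injective : Function.Injective translation := fun s t h => by
  have h1 : translation s • I = translation t • I := by rw [h]
  rw [translation_smul, translation_smul] at h1
  exact (UpperHalfPlane.vadd_right_cancel_iff I).1 h1

theorem exists_smul_infty_eq (x : OnePoint ℝ) :
    ∃ σ : PSL(2, ℝ), σ • (OnePoint.infty : OnePoint ℝ) = x := by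
  induction x with
  | infty => exact ⟨1, one_smul _ _⟩
  | coe x =>
    set g : SL(2, ℝ) := ⟨!![x, -1; 1, 0], by simp⟩ with hg
    refine ⟨(g : PSL(2, ℝ)), ?_⟩
    have e00 : (g : GL (Fin 2) ℝ) 0 0 = x := rfl
    have e10 : (g : GL (Fin 2) ℝ) 1 0 = 1 := rfl
    rw [mk_smul_boundary, OnePoint.smul_infty_eq_ite, e00, e10, if_neg one_ne_zero, div_one]

/-- An upper triangular matrix with distinct diagonal entries fixes a second, finite boundary point.
So the entries agree, and determinant one makes both `1` or both `-1`. -/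
theorem exists_eq_translation {δ : PSL(2, ℝ)}
    (h : δ • (OnePoint.infty : OnePoint ℝ) = OnePoint.infty)
    (hu : δ ≠ 1 → IsUnipotent δ) : ∃ c, δ = translation c := by
  by_cases h1 : δ = 1
  · exact ⟨0, by rw [h1, translation_zero]⟩
  obtain ⟨y, -, hy⟩ := hu h1
  induction δ using QuotientGroup.induction_on with
  | H g =>
    rw [mk_smul_boundary, OnePoint.smul_infty_eq_self_iff] at h
    have h10 : g 1 0 = 0 := h
    have hdet : g 0 0 * g 1 1 = 1 := by
      have := g.det_coe
      rw [Matrix.det_fin_two, h10, mul_zero, sub_zero] at this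
      exact this
    have h11 : g 1 1 ≠ 0 := right_ne_zero_of_mul_eq_one hdet
    have heq : g 0 0 = g 1 1 := by
      by_contra hne
      have hsub : g 1 1 - g 0 0 ≠ 0 := sub_ne_zero.2 (Ne.symm hne)
      set x : ℝ := g 0 1 / (g 1 1 - g 0 0) with hx
      have hfix : ((g : SL(2, ℝ)) : PSL(2, ℝ)) • (x : OnePoint ℝ) = x := by
        rw [mk_smul_boundary, OnePoint.smul_some_eq_ite]
        have e10 : (g : GL (Fin 2) ℝ) 1 0 = 0 := h10
        have e11 : (g : GL (Fin 2) ℝ) 1 1 = g 1 1 := rfl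
        have e00 : (g : GL (Fin 2) ℝ) 0 0 = g 0 0 := rfl
        have e01 : (g : GL (Fin 2) ℝ) 0 1 = g 0 1 := rfl
        rw [e10, e11, e00, e01, zero_mul, zero_add, if_neg h11]
        congr 1
        rw [hx]
        field_simp
        ring
      have hinf : ((g : SL(2, ℝ)) : PSL(2, ℝ)) • (OnePoint.infty : OnePoint ℝ) =
          OnePoint.infty := by
        rw [mk_smul_boundary, OnePoint.smul_infty_eq_self_iff]
        exact h10
      exact OnePoint.infty_ne_coe x ((hy _ hinf).trans (hy _ hfix).symm)
    refine ⟨g 0 1 * g 1 1, ?_⟩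
    rw [translation, QuotientGroup.eq, Matrix.SpecialLinearGroup.mem_center_iff]
    have hsq : g 1 1 * g 1 1 = 1 := by rw [heq] at hdet; exact hdet
    refine ⟨g 1 1, by rw [Fintype.card_fin, sq, hsq], ?_⟩
    rw [Matrix.SpecialLinearGroup.coe_mul, coe_translationMatrix,
      Matrix.SpecialLinearGroup.coe_inv, Matrix.adjugate_fin_two, h10, heq]
    ext i j
    fin_cases i <;> fin_cases j <;> simp
    linear_combination (-g 0 1) * hsq

/-- Every unipotent one-parameter subgroup is conjugate to a group of translations. -/
theorem IsUnipotentSubgroup.exists_conj {γ : ℝ → PSL(2, ℝ)} (hγ : IsUnipotentSubgroup γ) :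
    ∃ (σ : PSL(2, ℝ)) (c : ℝ), c ≠ 0 ∧ ∀ t, γ t = σ * translation (c * t) * σ⁻¹ := by
  obtain ⟨t₀, ht₀⟩ := hγ.nontrivial
  obtain ⟨x, hx, hxu⟩ := hγ.unipotent t₀ ht₀
  -- The group is commutative, so `γ t` preserves the fixed-point set of `γ t₀`, a singleton.
  have hfix : ∀ t, γ t • x = x := fun t => hxu _ <| by
    change γ t₀ • γ t • x = γ t • x
    rw [← mul_smul, ← hγ.map_add, add_comm, hγ.map_add, mul_smul, hx]
  obtain ⟨σ, hσ⟩ := exists_smul_infty_eq x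
  have h : ∀ t, ∃ c, σ⁻¹ * γ t * σ = translation c := fun t => by
    refine exists_eq_translation ?_ fun hne => ?_
    · rw [mul_smul, mul_smul, hσ, hfix, inv_smul_eq_iff, hσ]
    · have hne' : γ t ≠ 1 := fun h1 => hne (by rw [h1, mul_one, inv_mul_cancel])
      obtain ⟨y, hy, hyu⟩ := hγ.unipotent t hne'
      refine ⟨σ⁻¹ • y, ?_, fun w hw => ?_⟩
      · change (σ⁻¹ * γ t * σ) • σ⁻¹ • y = σ⁻¹ • y
        rw [mul_smul, smul_inv_smul, mul_smul, hy]
      · rw [eq_inv_smul_iff]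
        refine hyu _ ?_
        change γ t • σ • w = σ • w
        have hw' : (σ⁻¹ * γ t * σ) • w = w := hw
        rwa [mul_smul, mul_smul, inv_smul_eq_iff] at hw'
  choose c hc using h
  have hadd : ∀ s t, c (s + t) = c s + c t := fun s t => translation_injective <| by
    rw [← translation_mul, ← hc, ← hc, ← hc, hγ.map_add]
    group
  have hcont : Continuous c := by
    have h1 : ∀ t, c t = ((σ⁻¹ * γ t * σ) • I).re := fun t => by
      rw [hc, translation_smul, vadd_re]
      simp
    have h2 : Continuous fun t => (σ⁻¹ * γ t * σ) • I :=
      ((continuous_const.mul hγ.continuous).mul continuous_const).smul continuous_const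
    rw [funext h1]
    exact UpperHalfPlane.continuous_re.comp h2
  have hlin : ∀ t, c t = c 1 * t := fun t => by
    have := map_real_smul (AddMonoidHom.mk' c hadd) hcont t 1
    simpa [mul_comm] using this
  have hconj : ∀ t, γ t = σ * translation (c 1 * t) * σ⁻¹ := fun t => by
    rw [← hlin, ← hc]
    group
  refine ⟨σ, c 1, fun h0 => ht₀ ?_, hconj⟩
  rw [hconj, h0, zero_mul, translation_zero, mul_one, mul_inv_cancel]

/-! ### The conjugation action and derivatives along the diagonal -/

theorem differentiableAt_smul_ofComplex (σ : PSL(2, ℝ)) {w : ℂ} (hw : 0 < w.im) :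
    DifferentiableAt ℂ (fun w : ℂ => ((σ • ofComplex w : ℍ) : ℂ)) w := by
  induction σ using QuotientGroup.induction_on with
  | H g => exact (analyticAt_smul (g := (g : GL (Fin 2) ℝ)) (by simp) ⟨w, hw⟩).differentiableAt

namespace D

theorem tendsto_const_smul (σ : PSL(2, ℝ)) {ι : Type*} {l : Filter ι} {F : ι → D n} {g : D n}
    (h : Tendsto F l (𝓝 g)) : Tendsto (fun i => σ • F i) l (𝓝 (σ • g)) :=
  tendsto_of_forall_tendsto fun z =>
    ((continuous_const_smul σ).tendsto _).comp
      (((continuous_apply fun j => σ⁻¹ • z j).tendsto g).comp h)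

/-- Since `f` fixes the diagonal, the chain rule multiplies the derivative by those of `σ` and `σ⁻¹`
at corresponding points, which cancel. -/
theorem HasDiagDeriv.smul {f : D n} {α : Fin n → ℝ} (h : f.HasDiagDeriv α) (σ : PSL(2, ℝ)) :
    (σ • f).HasDiagDeriv α := by
  refine hasDiagDeriv_iff.2 fun j l => ?_
  set l' : ℍ := σ⁻¹ • l with hl'
  set m : ℂ → ℂ := fun w => ((σ • ofComplex w : ℍ) : ℂ) with hm
  set m' : ℂ → ℂ := fun w => ((σ⁻¹ • ofComplex w : ℍ) : ℂ) with hm'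
  have hml : m' l = l' := by simp [hm', hl']
  have h1 : HasDerivAt m' (deriv m' l) l :=
    (differentiableAt_smul_ofComplex σ⁻¹ l.im_pos).hasDerivAt
  have h2 : HasDerivAt (fun w : ℂ => toComplexFun f (Function.update (fun _ => (l' : ℂ)) j w))
      (α j) (m' l) := by
    rw [hml, ← h _ l'.im_pos j]
    exact f.hasDerivAt_update_diag j l'.im_pos
  have h3 : HasDerivAt m (deriv m l') l' :=
    (differentiableAt_smul_ofComplex σ l'.im_pos).hasDerivAt
  have hval : toComplexFun f (Function.update (fun _ => (l' : ℂ)) j (m' l)) = l' := by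
    rw [hml, show Function.update (fun _ : Fin n => (l' : ℂ)) j l' = fun _ => (l' : ℂ) from
      Function.update_eq_self j _]
    exact f.toComplexFun_diag l'.im_pos
  have h4 : HasDerivAt m (deriv m l')
      (toComplexFun f (Function.update (fun _ => (l' : ℂ)) j (m' l))) := by rwa [hval]
  have h5 : HasDerivAt m (deriv m l') (m' l) := by rwa [hml]
  have hcomp := h4.comp (l : ℂ) (h2.comp (l : ℂ) h1)
  have hid : m ∘ m' =ᶠ[𝓝 (l : ℂ)] id := by
    filter_upwards [isOpen_upperHalfPlaneSet.mem_nhds l.im_pos] with w hw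
    simp [hm, hm', ofComplex_apply_of_im_pos hw]
  have hprod : deriv m l' * deriv m' l = 1 :=
    ((h5.comp (l : ℂ) h1).congr_of_eventuallyEq hid.symm).unique (hasDerivAt_id (l : ℂ))
  have hfun : (fun w : ℂ => toComplexFun (σ • f) (Function.update (fun _ => (l : ℂ)) j w)) =
      m ∘ ((fun w : ℂ => toComplexFun f (Function.update (fun _ => (l' : ℂ)) j w)) ∘ m') := by
    ext w
    simp only [hm, toComplexFun, D.smul_apply, Function.comp_apply, ofComplex_apply]
    congr 3
    ext i
    by_cases hi : i = j
    · subst hi; simp [hm']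
    · simp [hi, hl']
  rw [partialDeriv, hfun]
  refine hcomp.deriv.trans ?_
  linear_combination (α j : ℂ) * hprod

/-- Under a unipotent one-parameter subgroup, the orbit of `f` converges as `|t| → ∞`, to a limit
depending only on the derivatives of `f` along the diagonal. -/
theorem HasDiagDeriv.exists_tendsto {α : Fin n → ℝ} (h0 : ∀ j, 0 ≤ α j) (h1 : ∑ j, α j = 1)
    {γ : ℝ → PSL(2, ℝ)} (hγ : IsUnipotentSubgroup γ) :
    ∃ g : D n, g.HasDiagDeriv α ∧ ∀ f : D n, f.HasDiagDeriv α →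
      Tendsto (fun t => γ t • f) (cocompact ℝ) (𝓝 g) := by
  obtain ⟨σ, c, hc, hσ⟩ := hγ.exists_conj
  refine ⟨σ • linear α h0 h1, (hasDiagDeriv_linear α h0 h1).smul σ, fun f hf => ?_⟩
  have ht := tendsto_const_smul σ (((hf.smul σ⁻¹).tendsto_translation_smul h0).comp
    (Homeomorph.mulLeft₀ c hc).isClosedEmbedding.tendsto_cocompact)
  refine ht.congr fun t => ?_
  rw [hσ, mul_smul, mul_smul]
  rfl

end D

/-! ### Averages -/

/-- Rescaling to a fixed interval moves `r` into the integrand, ready for dominated convergence. -/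
theorem integral_uniformMeasure (h : ℝ → ℝ) (r : Set.Ioi (0 : ℝ)) :
    ∫ t, h t ∂(uniformMeasure r : Measure ℝ) =
      2⁻¹ * ∫ s in (-1 : ℝ)..1, h (r * s) := by
  have hr : 0 < (r : ℝ) := r.2
  have e : (uniformMeasure r : Measure ℝ) =
      ProbabilityTheory.cond volume (Set.Icc (-r : ℝ) r) := rfl
  rw [e, ProbabilityTheory.cond, integral_smul_measure, Real.volume_Icc,
    integral_Icc_eq_integral_Ioc,
    ← intervalIntegral.integral_of_le (by linarith),
    intervalIntegral.integral_comp_mul_left _ hr.ne',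
    ENNReal.toReal_inv, ENNReal.toReal_ofReal (by linarith), smul_eq_mul, smul_eq_mul, mul_neg,
    mul_one, ← mul_assoc]
  congr 1
  field_simp
  ring

theorem tendsto_integral_uniformMeasure {h : ℝ → ℝ} (hc : Continuous h) {C L : ℝ}
    (hC : ∀ t, ‖h t‖ ≤ C) (hL : Tendsto h (cocompact ℝ) (𝓝 L)) :
    Tendsto (fun r : Set.Ioi (0 : ℝ) => ∫ t, h t ∂(uniformMeasure r : Measure ℝ)) atTop (𝓝 L) := by
  simp only [integral_uniformMeasure]
  have key : Tendsto (fun r : ℝ => ∫ s in (-1 : ℝ)..1, h (r * s)) atTop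
      (𝓝 (∫ _ in (-1 : ℝ)..1, L)) := by
    refine intervalIntegral.tendsto_integral_filter_of_dominated_convergence (fun _ => C)
      ?_ ?_ ?_ ?_
    · exact Eventually.of_forall fun r =>
        (by fun_prop : Continuous fun s => h (r * s)).aestronglyMeasurable
    · exact Eventually.of_forall fun r => Eventually.of_forall fun s _ => hC _
    · exact intervalIntegrable_const
    -- For `s ≠ 0` the argument `r * s` leaves every compact set; `s = 0` is a null set.
    · filter_upwards [compl_mem_ae_iff.2 (measure_singleton (0 : ℝ))] with s hs _
      refine hL.comp ?_
      rcases lt_or_gt_of_ne (show s ≠ 0 from hs) with hs | hs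
      · exact (tendsto_id.atTop_mul_const_of_neg hs).mono_right atBot_le_cocompact
      · exact (tendsto_id.atTop_mul_const hs).mono_right atTop_le_cocompact
  have := (tendsto_comp_val_Ioi_atTop (a := (0 : ℝ))).2 (key.const_mul 2⁻¹)
  convert this using 2
  rw [intervalIntegral.integral_const, smul_eq_mul]
  ring

theorem tendsto_orbitMeasure {γ : ℝ → PSL(2, ℝ)} (hγ : IsUnipotentSubgroup γ) {f g : D n}
    (h : Tendsto (fun t => γ t • f) (cocompact ℝ) (𝓝 g)) :
    Tendsto (fun r => orbitMeasure hγ f r) atTop (𝓝 (diracProba g)) := by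
  refine ProbabilityMeasure.tendsto_iff_forall_integral_tendsto.2 fun φ => ?_
  have hcont := continuous_orbit hγ.continuous f
  have h1 : ∀ r, ∫ x, φ x ∂(orbitMeasure hγ f r : Measure (D n)) =
      ∫ t, φ (γ t • f) ∂(uniformMeasure r : Measure ℝ) := fun r =>
    integral_map hcont.measurable.aemeasurable φ.continuous.measurable.aestronglyMeasurable
  have h2 : ∫ x, φ x ∂(diracProba g : Measure (D n)) = φ g :=
    integral_dirac' _ _ φ.continuous.measurable.stronglyMeasurable
  simp only [h1, h2]
  exact tendsto_integral_uniformMeasure (φ.continuous.comp hcont) (fun t => φ.norm_coe_le_norm _)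
    ((φ.continuous.tendsto g).comp h)

end DiagonalFamily

end

theorem theorem5p1 (n : ℕ) (f : DiagonalFamily.D n) :
    ∃ α : Fin n → ℝ,
      (∀ j, 0 ≤ α j) ∧
      (∀ (j : Fin n) (l : ℍ), DiagonalFamily.partialDeriv f j (fun _ => l) = (α j : ℂ)) ∧
      ∀ (γ : ℝ → PSL(2, ℝ)) (hγ : DiagonalFamily.IsUnipotentSubgroup γ),
        ∃ g : DiagonalFamily.D n,
          (γ 1 • g = g ∧
            ∀ (j : Fin n) (l : ℍ), DiagonalFamily.partialDeriv g j (fun _ => l) = (α j : ℂ)) ∧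
          (∀ g' : DiagonalFamily.D n,
            (γ 1 • g' = g' ∧
              ∀ (j : Fin n) (l : ℍ),
                DiagonalFamily.partialDeriv g' j (fun _ => l) = (α j : ℂ)) →
            g' = g) ∧
          Tendsto (fun r : Set.Ioi (0 : ℝ) => DiagonalFamily.orbitMeasure hγ f r) atTop
            (𝓝 (diracProba g)) := by
  obtain ⟨α, h0, hα⟩ := f.exists_diagDeriv_eq
  have hf : f.HasDiagDeriv α := hα
  refine ⟨α, h0, DiagonalFamily.D.hasDiagDeriv_iff.1 hf, fun γ hγ => ?_⟩
  obtain ⟨g, hg, hlim⟩ := DiagonalFamily.D.HasDiagDeriv.exists_tendsto h0 hf.sum_eq_one hγ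
  refine ⟨g, ⟨?_, DiagonalFamily.D.hasDiagDeriv_iff.1 hg⟩, fun g' ⟨hfix, hg'⟩ => ?_,
    DiagonalFamily.tendsto_orbitMeasure hγ (hlim f hf)⟩
  -- Both `γ 1 • g` and `g` are limits of `γ (1 + t) • f`.
  · have h1 := DiagonalFamily.D.tendsto_const_smul (γ 1) (hlim f hf)
    have h2 := (hlim f hf).comp (Homeomorph.addLeft (1 : ℝ)).isClosedEmbedding.tendsto_cocompact
    refine tendsto_nhds_unique h1 (h2.congr fun t => ?_)
    change γ (1 + t) • f = γ 1 • γ t • f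
    rw [hγ.map_add, mul_smul]
  -- Starting at exponent one lets `hfix` be the base case.
  · have hfix' : ∀ m : ℕ, γ (m + 1) • g' = g' := fun m => by
      induction m with
      | zero => simpa using hfix
      | succ m ih => rw [Nat.cast_succ, hγ.map_add, mul_smul, hfix, ih]
    have h1 := (hlim g' (DiagonalFamily.D.hasDiagDeriv_iff.2 hg')).comp
      ((tendsto_atTop_add_const_right atTop (1 : ℝ) tendsto_natCast_atTop_atTop).mono_right
        atTop_le_cocompact)
    exact tendsto_nhds_unique (tendsto_const_nhds.congr fun m : ℕ => (hfix' m).symm) h1
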